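/- Let $k$ be a field of characteristic $p>0$. A linear algebraic group over $k$ is a smooth connected affine group scheme of finite type over $k$; a closed embedding of such groups is a closed immersion that is a group homomorphism. For $N\ge 0$ let $\mathcal O(GL_N)_{\le d}\subset\mathcal O(GL_N)=k[x_{i,j}][\det^{-1}]$ be the $k$-span of all $f\cdot\det^{i}$, where $i\in\mathbb Z$ and $f\in k[x_{i,j}]$ is a polynomial with $\deg f+N|i|\le d$. For a closed embedding $\phi:\mathbb G\hookrightarrow GL_N$ put $\mathcal O(\mathbb G)_{\le d,\phi}=\phi^*(\mathcal O(GL_N)_{\le d})$. For a $\mathbb G$-submodule $M$ of the right regular representation $k[\mathbb G]^R$ (that is, $\mathcal O(\mathbb G)$ with coaction the comultiplication $\Delta$) let $M_{\le d,\phi}$ be the largest $\mathbb G$-submodule $M'$ of $M$ with $\Delta(M')\subset M'\otimes\mathcal O(\mathbb G)_{\le d,\phi}$. A function $f:\mathbb N\to\mathbb N$ has polynomial growth of degree $e$ if $\lim_{d\to\infty} f(d)/d^{e}$ exists and is a positive real number. Let $\phi:\mathbb G\hookrightarrow GL_N$ be a closed embedding of a linear algebraic group with Lie algebra $\mathfrak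 g$. Then $d\mapsto\dim_k\mathcal O(\mathbb G)_{\le d,\phi}$ has polynomial growth of degree $\dim\mathfrak g$. Moreover, let $\mathbb H\hookrightarrow\mathbb G$ be a closed embedding of linear algebraic groups, with $\mathfrak h$ the Lie algebra of $\mathbb H$, such that the quotient $\mathbb G/\mathbb H$ (the fppf quotient sheaf) is affine. Then $\dim\mathfrak h\le\dim\mathfrak g$. View $\mathcal O(\mathbb G/\mathbb H)$ as a $\mathbb G$-submodule $M=k[\mathbb G/\mathbb H]^R$ of $k[\mathbb G]^R$ by pulling functions back along $\mathbb G\to\mathbb G/\mathbb H$, $g\mapsto g^{-1}\mathbb H$. Then $d\mapsto\dim_k M_{\le d,\phi}$ has polynomial growth of degree $\dim\mathfrak g-\dim\mathfrak h$. The same holds for $d\mapsto\dim_k\bigl(\mathcal O(\mathbb G/\mathbb H)\cap\mathcal O(\mathbb G)_{\le d,\phi}\bigr)$, where now $\mathcal O(\mathbb G/\mathbb H)\subset\mathcal O(\mathbb G)$ by pullback along $g\mapsto g\mathbb H$. -/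

import Mathlib

open scoped TensorProduct
open Filter Topology

universe u

noncomputable section

/-! ### The coordinate Hopf algebra of `GL_N` -/

/-- The determinant of the generic `N × N` matrix, as an element of
`O(M_{N,N}) = k[x_{i,j}]`. -/
def genericDet (k : Type u) [Field k] (N : ℕ) : MvPolynomial (Fin N × Fin N) k :=
  (Matrix.mvPolynomialX (Fin N) (Fin N) k).det

/-- `O(GL_N) = k[x_{i,j}][1 / det]`. -/
abbrev GLCoord (k : Type u) [Field k] (N : ℕ) : Type u :=
  Localization.Away (genericDet k N)

namespace GLCoord

variable (k : Type u) [Field k] (N : ℕ)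

/-- The restriction map `O(M_{N,N}) → O(GL_N)`. -/
def ofPoly : MvPolynomial (Fin N × Fin N) k →ₐ[k] GLCoord k N :=
  IsScalarTower.toAlgHom k (MvPolynomial (Fin N × Fin N) k) (GLCoord k N)

/-- The matrix `(x_{i,j})` over `O(GL_N)`. -/
def X : Matrix (Fin N) (Fin N) (GLCoord k N) :=
  Matrix.of fun i j => ofPoly k N (MvPolynomial.X (i, j))

theorem X_eq_map : X k N = (ofPoly k N).mapMatrix (Matrix.mvPolynomialX (Fin N) (Fin N) k) := by
  ext i j
  simp [X, Matrix.mvPolynomialX]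

theorem det_X : (X k N).det = ofPoly k N (genericDet k N) := by
  rw [X_eq_map, ← AlgHom.map_det]
  rfl

theorem isUnit_det_X : IsUnit (X k N).det := by
  rw [det_X]
  exact IsLocalization.Away.algebraMap_isUnit (S := GLCoord k N) (genericDet k N)

/-- The determinant as a unit of `O(GL_N)`. -/
def detUnit : (GLCoord k N)ˣ := (isUnit_det_X k N).unit

variable {k N}

theorem aeval_genericDet {S : Type*} [CommRing S] [Algebra k S] (M : Matrix (Fin N) (Fin N) S) :
    MvPolynomial.aeval (fun ij : Fin N × Fin N => M ij.1 ij.2) (genericDet k N) = M.det := by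
  rw [genericDet, AlgHom.map_det]
  congr 1
  ext i j
  simp [Matrix.mvPolynomialX]

/-- `GL_N(S) → Hom(O(GL_N), S)`: the algebra map attached to an invertible matrix. -/
def lift {S : Type*} [CommRing S] [Algebra k S] (M : Matrix (Fin N) (Fin N) S)
    (hM : IsUnit M.det) : GLCoord k N →ₐ[k] S :=
  IsLocalization.liftAlgHom (M := Submonoid.powers (genericDet k N))
    (f := MvPolynomial.aeval (fun ij : Fin N × Fin N => M ij.1 ij.2)) (by
      rintro ⟨_, n, rfl⟩
      simpa [aeval_genericDet] using hM.pow n)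

@[simp]
theorem lift_X {S : Type*} [CommRing S] [Algebra k S] (M : Matrix (Fin N) (Fin N) S)
    (hM : IsUnit M.det) (i j : Fin N) : lift (k := k) M hM (X k N i j) = M i j := by
  have h := IsLocalization.lift_eq (M := Submonoid.powers (genericDet k N)) (S := GLCoord k N)
    (g := (MvPolynomial.aeval (R := k) (fun ij : Fin N × Fin N => M ij.1 ij.2)).toRingHom) (by
      rintro ⟨_, n, rfl⟩
      simpa [aeval_genericDet] using hM.pow n) (MvPolynomial.X (i, j))
  refine h.trans ?_
  simp

theorem algHom_ext {S : Type*} [CommRing S] [Algebra k S] {f g : GLCoord k N →ₐ[k] S}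
    (h : ∀ i j, f (X k N i j) = g (X k N i j)) : f = g := by
  refine IsLocalization.algHom_ext (Submonoid.powers (genericDet k N)) ?_
  ext ⟨i, j⟩
  exact h i j

theorem lift_mapMatrix_X {S : Type*} [CommRing S] [Algebra k S] (M : Matrix (Fin N) (Fin N) S)
    (hM : IsUnit M.det) : (lift (k := k) M hM).mapMatrix (X k N) = M := by
  ext i j
  simp

theorem isUnit_det_map {S : Type*} [CommRing S] [Algebra k S] (f : GLCoord k N →ₐ[k] S) :
    IsUnit (f.mapMatrix (X k N)).det := by
  rw [← AlgHom.map_det]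
  exact (isUnit_det_X k N).map f

variable (k N)

/-- The matrix with entries `∑ s, x_{i,s} ⊗ x_{s,j}`. -/
def comulMatrix : Matrix (Fin N) (Fin N) (GLCoord k N ⊗[k] GLCoord k N) :=
  (Algebra.TensorProduct.includeLeft : GLCoord k N →ₐ[k] GLCoord k N ⊗[k] GLCoord k N).mapMatrix
      (X k N) *
    (Algebra.TensorProduct.includeRight : GLCoord k N →ₐ[k] GLCoord k N ⊗[k] GLCoord k N).mapMatrix
      (X k N)

theorem comulMatrix_apply (i j : Fin N) :
    comulMatrix k N i j = ∑ s, X k N i s ⊗ₜ[k] X k N s j := by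
  simp [comulMatrix, Matrix.mul_apply]

theorem isUnit_det_comulMatrix : IsUnit (comulMatrix k N).det := by
  rw [comulMatrix, Matrix.det_mul]
  exact (isUnit_det_map _).mul (isUnit_det_map _)

/-- The comultiplication `x_{i,j} ↦ ∑ s, x_{i,s} ⊗ x_{s,j}` of `O(GL_N)`. -/
def comulHom : GLCoord k N →ₐ[k] GLCoord k N ⊗[k] GLCoord k N :=
  lift (comulMatrix k N) (isUnit_det_comulMatrix k N)

/-- The counit of `O(GL_N)`: evaluation at the identity matrix. -/
def counitHom : GLCoord k N →ₐ[k] k :=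
  lift (1 : Matrix (Fin N) (Fin N) k) (by simp)

/-- The antipode of `O(GL_N)`, corresponding to matrix inversion. -/
def antipodeHom : GLCoord k N →ₐ[k] GLCoord k N :=
  lift (X k N)⁻¹ (by
    rw [Matrix.det_nonsing_inv]
    exact (isUnit_det_X k N).ringInverse)

@[simp]
theorem comulHom_X (i j : Fin N) :
    comulHom k N (X k N i j) = ∑ s, X k N i s ⊗ₜ[k] X k N s j := by
  rw [comulHom, lift_X, comulMatrix_apply]

@[simp]
theorem counitHom_X (i j : Fin N) :
    counitHom k N (X k N i j) = (1 : Matrix (Fin N) (Fin N) k) i j := by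
  rw [counitHom, lift_X]

@[simp]
theorem antipodeHom_X (i j : Fin N) :
    antipodeHom k N (X k N i j) = (X k N)⁻¹ i j := by
  rw [antipodeHom, lift_X]

theorem comul_coassoc :
    (Algebra.TensorProduct.assoc k k k (GLCoord k N) (GLCoord k N) (GLCoord k N)).toAlgHom.comp
        ((Algebra.TensorProduct.map (comulHom k N) (.id k (GLCoord k N))).comp (comulHom k N)) =
      (Algebra.TensorProduct.map (.id k (GLCoord k N)) (comulHom k N)).comp (comulHom k N) := by
  refine algHom_ext (S := GLCoord k N ⊗[k] (GLCoord k N ⊗[k] GLCoord k N)) fun i j => ?_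
  have h : ∀ a b c : GLCoord k N,
      (Algebra.TensorProduct.assoc k k k (GLCoord k N) (GLCoord k N) (GLCoord k N)).toAlgHom
        (a ⊗ₜ[k] b ⊗ₜ[k] c) = a ⊗ₜ[k] (b ⊗ₜ[k] c) := fun _ _ _ => rfl
  simp only [AlgHom.coe_comp, Function.comp_apply, comulHom_X, map_sum,
    Algebra.TensorProduct.map_tmul, AlgHom.coe_id, id_eq, TensorProduct.sum_tmul,
    TensorProduct.tmul_sum, h]
  exact Finset.sum_comm

theorem counit_left :
    (Algebra.TensorProduct.map (counitHom k N) (.id k (GLCoord k N))).comp (comulHom k N) =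
      (Algebra.TensorProduct.lid k (GLCoord k N)).symm := by
  refine algHom_ext fun i j => ?_
  simp only [AlgHom.coe_comp, Function.comp_apply, comulHom_X, map_sum,
    Algebra.TensorProduct.map_tmul, counitHom_X, AlgHom.coe_id, id_eq]
  rw [Finset.sum_eq_single i]
  · simp
  · intro s _ hs
    simp [Matrix.one_apply_ne' hs]
  · simp

theorem counit_right :
    (Algebra.TensorProduct.map (.id k (GLCoord k N)) (counitHom k N)).comp (comulHom k N) =
      (Algebra.TensorProduct.rid k k (GLCoord k N)).symm := by
  refine algHom_ext fun i j => ?_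
  simp only [AlgHom.coe_comp, Function.comp_apply, comulHom_X, map_sum,
    Algebra.TensorProduct.map_tmul, counitHom_X, AlgHom.coe_id, id_eq]
  rw [Finset.sum_eq_single j]
  · simp
  · intro s _ hs
    simp [Matrix.one_apply_ne hs]
  · simp

instance : Bialgebra k (GLCoord k N) :=
  Bialgebra.ofAlgHom (comulHom k N) (counitHom k N)
    (comul_coassoc k N) (counit_left k N) (counit_right k N)

theorem lift_comul_X (f g : GLCoord k N →ₐ[k] GLCoord k N) (i j : Fin N) :
    Algebra.TensorProduct.lift f g (fun _ _ => Commute.all _ _) (comulHom k N (X k N i j)) =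
      (f.mapMatrix (X k N) * g.mapMatrix (X k N)) i j := by
  rw [comulHom_X, map_sum, Matrix.mul_apply]
  exact Finset.sum_congr rfl fun s _ => Algebra.TensorProduct.lift_tmul _ _ _ _ _

theorem ofId_counit_X (i j : Fin N) :
    Algebra.ofId k (GLCoord k N) (counitHom k N (X k N i j)) =
      (1 : Matrix (Fin N) (Fin N) (GLCoord k N)) i j := by
  rw [counitHom_X]
  by_cases h : i = j <;> simp [h, Matrix.one_apply]

theorem antipode_mapMatrix_X : (antipodeHom k N).mapMatrix (X k N) = (X k N)⁻¹ :=
  lift_mapMatrix_X _ _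

theorem id_mapMatrix_X : (AlgHom.id k (GLCoord k N)).mapMatrix (X k N) = X k N := by
  ext i j
  simp

instance : HopfAlgebra k (GLCoord k N) :=
  HopfAlgebra.ofAlgHom (antipodeHom k N)
    (by
      refine algHom_ext fun i j => ?_
      refine (lift_comul_X k N _ _ i j).trans (Eq.trans ?_ (ofId_counit_X k N i j).symm)
      rw [antipode_mapMatrix_X, id_mapMatrix_X, Matrix.nonsing_inv_mul _ (isUnit_det_X k N)])
    (by
      refine algHom_ext fun i j => ?_
      refine (lift_comul_X k N _ _ i j).trans (Eq.trans ?_ (ofId_counit_X k N i j).symm)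
      rw [antipode_mapMatrix_X, id_mapMatrix_X, Matrix.mul_nonsing_inv _ (isUnit_det_X k N)])

/-- `O(GL_N)_{≤ d}`: the image of
`∑_{a + b ≤ d} O(M_{N,N})_{≤ a} ⊗ O(G_m)_{≤ b}` under the restriction map
`O(M_{N,N}) ⊗ k[t, t⁻¹] → O(GL_N)` along `g ↦ (g, det(g)⁻¹)`. Here `O(M_{N,N})_{≤ a}` consists of
the polynomials of total degree at most `a`, and `O(G_m)_{≤ b}` is spanned by the `t ^ i` with
`N * |i| ≤ b`. -/
def filtration (d : ℕ) : Submodule k (GLCoord k N) :=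
  Submodule.span k
    {x | ∃ (f : MvPolynomial (Fin N × Fin N) k) (i : ℤ),
      f.totalDegree + N * i.natAbs ≤ d ∧
        x = ofPoly k N f * ((detUnit k N ^ i : (GLCoord k N)ˣ) : GLCoord k N)}

end GLCoord

/-! ### Affine group schemes through their coordinate Hopf algebras -/

section Group

variable {k : Type u} [Field k] {A B C : Type u} [CommRing A] [HopfAlgebra k A]
  [CommRing B] [HopfAlgebra k B] [CommRing C] [Algebra k C]

/-- `O(G)_{≤ d, φ} = φ^*(O(GL_N)_{≤ d})`, for a homomorphism `φ : G → GL_N` given by its comorphism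
`O(GL_N) → O(G) = A`. -/
def groupFiltration {N : ℕ} (φ : GLCoord k N →ₐc[k] A) (d : ℕ) : Submodule k A :=
  (GLCoord.filtration k N d).map (φ : GLCoord k N →ₗ[k] A)

/-- The Lie algebra of `G`, as a vector space: the tangent space `(I / I²)^*` at the identity,
where `I` is the augmentation ideal of `A = O(G)`. -/
abbrev LieSpace (k A : Type u) [Field k] [CommRing A] [HopfAlgebra k A] : Type u :=
  Module.Dual k (RingHom.ker (Bialgebra.counitAlgHom k A)).Cotangent

/-- The product `g * g'` in the group `G(R) = Hom(A, R)`. -/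
def pointMul {R : Type u} [CommRing R] [Algebra k R] (g g' : A →ₐ[k] R) : A →ₐ[k] R :=
  (Algebra.TensorProduct.lift g g' fun _ _ => Commute.all _ _).comp (Bialgebra.comulAlgHom k A)

/-- Let `H → G` be a homomorphism with comorphism `π : A = O(G) → O(H) = B` and let
`G → Spec C` be a morphism with comorphism `q`. This says that `Spec C`, with this morphism,
is the quotient `G/H`, i.e. that it represents the fppf sheaf associated with the presheaf
`R ↦ G(R)/H(R)`: two elements of `G(R)` have the same image in `(Spec C)(R)` if and only if they lie
in the same left coset `g H(R)`, and every element of `(Spec C)(R)` lifts to `G` after some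
faithfully flat and finitely presented extension `R → R'`. -/
structure IsAffineQuotient (π : A →ₐc[k] B) (q : C →ₐ[k] A) : Prop where
  fibre : ∀ (R : Type u) [CommRing R] [Algebra k R] (g g' : A →ₐ[k] R),
    g.comp q = g'.comp q ↔ ∃ h : B →ₐ[k] R, g' = pointMul g (h.comp (π : A →ₐ[k] B))
  locally_lifts : ∀ (R : Type u) [CommRing R] [Algebra k R] (x : C →ₐ[k] R),
    ∃ (R' : Type u) (_ : CommRing R') (_ : Algebra k R') (ι : R →ₐ[k] R') (g : A →ₐ[k] R'),
      ι.toRingHom.FaithfullyFlat ∧ ι.toRingHom.FinitePresentation ∧ g.comp q = ι.comp x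

/-- For subspaces `M` and `X` of `A = O(G)`, with `M` a submodule of the right regular
representation `k[G]^R` (whose coaction is the comultiplication `Δ : A → A ⊗ A`), this is
`M_X`: the largest submodule `N` of `M` on which the coaction factors through `N ⊗ X`. -/
def regularPart (M X : Submodule k A) : Submodule k A :=
  sSup {N : Submodule k A | N ≤ M ∧
    N.map (Coalgebra.comul (R := k) (A := A)) ≤
      LinearMap.range (TensorProduct.map N.subtype X.subtype)}

/-- `k[G/H]^R`: the coordinate algebra of `Spec C = G/H`, viewed inside `O(G)` through the morphism
`G → G/H`, `g ↦ g⁻¹ H`. Its elements are the functions `f` on `G` with `f(h g) = f(g)`, so that it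
is a submodule of the right regular representation. -/
def quotientRight (q : C →ₐ[k] A) : Submodule k A :=
  q.range.toSubmodule.map (HopfAlgebra.antipode k (A := A))

/-- `f` has polynomial growth of degree `e`: the sequence `f d / d ^ e` has a positive limit. -/
def HasPolynomialGrowth (f : ℕ → ℕ) (e : ℕ) : Prop :=
  ∃ c : ℝ, 0 < c ∧ Tendsto (fun d : ℕ => (f d : ℝ) / (d : ℝ) ^ e) atTop (𝓝 c)

end Group

end

/-!
The growth of a multiplicative filtration is read off from initial exponents in a power series ring.

Let `n = dim m / m ^ 2`, where `m` is the augmentation ideal of `A = O(G)`. Since `A` is smooth,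
coordinates at the identity define a homomorphism `ψ` from `A` to the power series in `n` variables
(`IsCoordinateSystem.exists_algHom`), whose kernel lies in all powers of `m`
(`IsCoordinateSystem.mem_ker_pow_of_map_eq_zero`). On a connected group the intersection of the
powers of `m` is zero (`eq_zero_of_forall_mem_augIdeal_pow`), so `ψ` is injective and `A` is a
domain. For a monomial order, the dimension of a subspace of `A` is the number of initial exponents
of its elements (`finrank_eq_ncard_initExps`), and products of functions have sums of exponents.
A filtration thus becomes a graded semigroup of exponents. If it contains the unit vectors in `e`
directions in some degree and has at most `C * d ^ e` elements in degree `d`, then it lies in the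
span of these directions, and adding small boxes to the multiples of its elements shows that its
counting function is nearly homogeneous of degree `e`, so that a variant of Fekete's lemma gives the
limit (`hasPolynomialGrowth_ncard`, `hasPolynomialGrowth_finrank`). What remains in each case is to
exhibit coordinates in the filtered piece and to prove the upper bound.

For `O(G)` itself, the filtration is contained in the powers of a finite-dimensional subspace, and
the function field of `G` is finite over the field of rational functions in the coordinates; clearing
denominators in a basis gives the bound (`IsCoordinateSystem.exists_finrank_pow_le`).

For the quotient, fppf descent identifies `O(G/H)` with the functions on `G` invariant under right
translations by `H` (`IsAffineQuotient.mem_range_iff`), and the ideal of `H` is generated by the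
functions on `G/H` that vanish at the base point (`IsAffineQuotient.ker_le_span`). Hence there are
coordinates of `G` of which the first `e = dim 𝔤 - dim 𝔥` are functions on `G/H` while the others
restrict to coordinates of `H` (`IsAffineQuotient.exists_coordinates`). Monomials in the latter are
linearly independent over `O(G/H)` (`IsAffineQuotient.eq_zero_of_sum_mul_eq_zero`), so that the
bound for `G` implies the bound `C * d ^ e` for `G/H` (`IsAffineQuotient.exists_finrank_inf_le`).
Finally, the filtered pieces of `O(G)` are subcoalgebras, so the regular part of `k[G/H]^R` is an
intersection (`regularPart_quotientRight`), and the antipode, which distorts the filtration only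
linearly, carries it to the functions on `G/H`.
-/

noncomputable section

/-! ### Counting points in graded semigroups of exponents -/

/-- A variant of Fekete's lemma: a monotone sequence bounded by a multiple of `d ^ e` that satisfies
`m ^ e * γ d ≤ γ (m * (d + c))` grows like a positive multiple of `d ^ e`. The limit is the supremum
of the numbers `γ d / (d + c) ^ e`. -/
theorem hasPolynomialGrowth_of_pow_mul_le {γ : ℕ → ℕ} {e c C : ℕ} (hc : 0 < c) (hmono : Monotone γ)
    (hpos : 0 < γ 0) (hbound : ∀ d, 1 ≤ d → γ d ≤ C * d ^ e)
    (hmul : ∀ m d, m ^ e * γ d ≤ γ (m * (d + c))) : HasPolynomialGrowth γ e := by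
  set a : ℕ → ℝ := fun d => (γ d : ℝ) / ((d : ℝ) + c) ^ e with ha
  have hc1 : (1 : ℝ) ≤ c := by exact_mod_cast hc
  have hden : ∀ d : ℕ, (0 : ℝ) < ((d : ℝ) + c) ^ e := fun d => by positivity
  have hbdd : BddAbove (Set.range a) := by
    refine ⟨C, ?_⟩
    rintro _ ⟨d, rfl⟩
    rw [ha, div_le_iff₀ (hden d)]
    have h1 : γ d ≤ C * (d + c) ^ e :=
      (hmono (Nat.le_add_right d c)).trans (hbound _ (by omega))
    exact_mod_cast h1
  set L := ⨆ d, a d with hL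
  have hle : ∀ d, a d ≤ L := fun d => le_ciSup hbdd d
  have hLpos : 0 < L := by
    refine lt_of_lt_of_le ?_ (hle 0)
    have : (0 : ℝ) < γ 0 := by exact_mod_cast hpos
    exact div_pos this (hden 0)
  refine ⟨L, hLpos, ?_⟩
  have hup : Tendsto (fun D : ℕ => L * (1 + (c : ℝ) / D) ^ e) atTop (𝓝 L) := by
    have h0 : Tendsto (fun D : ℕ => (c : ℝ) / D) atTop (𝓝 0) :=
      tendsto_const_div_atTop_nhds_zero_nat _
    simpa using ((h0.const_add 1).pow e).const_mul L
  rw [tendsto_order]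
  constructor
  · intro x hx
    obtain ⟨d, hd⟩ := exists_lt_of_lt_ciSup hx
    have hlow : Tendsto (fun D : ℕ => a d * (1 - ((d + c : ℕ) : ℝ) / D) ^ e) atTop (𝓝 (a d)) := by
      have h0 : Tendsto (fun D : ℕ => ((d + c : ℕ) : ℝ) / D) atTop (𝓝 0) :=
        tendsto_const_div_atTop_nhds_zero_nat _
      simpa using ((h0.const_sub 1).pow e).const_mul (a d)
    filter_upwards [(tendsto_order.1 hlow).1 x hd, eventually_ge_atTop (d + c)] with D hD hDc
    refine hD.trans_le ?_
    have hDpos : (0 : ℝ) < D := by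
      have : 0 < D := by omega
      exact_mod_cast this
    -- `D` is compared with the largest multiple of `d + c` below it
    set m := D / (d + c) with hm
    have hm1 : m * (d + c) ≤ D := Nat.div_mul_le_self _ _
    have hm2 : D ≤ m * (d + c) + (d + c) := by
      have := Nat.lt_div_mul_add (a := D) (b := d + c) (by omega)
      rw [← hm] at this
      omega
    have h1 : (m : ℝ) ^ e * γ d ≤ γ D := by
      exact_mod_cast (hmul m d).trans (hmono hm1)
    rw [le_div_iff₀ (by positivity), ha]
    have h2 : (1 - ((d + c : ℕ) : ℝ) / D) * D ≤ m * ((d : ℝ) + c) := by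
      rw [sub_mul, div_mul_cancel₀ _ hDpos.ne']
      have : (D : ℝ) ≤ m * ((d : ℝ) + c) + (d + c) := by exact_mod_cast hm2
      push_cast
      linarith
    have h3 : 0 ≤ 1 - ((d + c : ℕ) : ℝ) / D := by
      rw [sub_nonneg, div_le_one hDpos]
      exact_mod_cast hDc
    calc (γ d : ℝ) / ((d : ℝ) + c) ^ e * (1 - ((d + c : ℕ) : ℝ) / D) ^ e * (D : ℝ) ^ e
        = (γ d : ℝ) / ((d : ℝ) + c) ^ e * ((1 - ((d + c : ℕ) : ℝ) / D) * D) ^ e := by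
          rw [mul_pow]; ring
      _ ≤ (γ d : ℝ) / ((d : ℝ) + c) ^ e * (m * ((d : ℝ) + c)) ^ e := by
          gcongr
      _ = (m : ℝ) ^ e * γ d := by
          rw [mul_pow]
          field_simp [(hden d).ne']
      _ ≤ γ D := h1
  · intro x hx
    filter_upwards [(tendsto_order.1 hup).2 x hx, eventually_ge_atTop 1] with D hD hD1
    refine lt_of_le_of_lt ?_ hD
    have hDpos : (0 : ℝ) < D := by exact_mod_cast hD1
    rw [div_le_iff₀ (by positivity), mul_assoc, ← mul_pow, add_mul, one_mul,
      div_mul_cancel₀ _ hDpos.ne', ← div_le_iff₀ (hden D)]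
    exact hle D

theorem nsmul_mem_of_add_mem {M : Type*} [AddCommMonoid M] {S : ℕ → Set M} (h0 : 0 ∈ S 0)
    (hadd : ∀ a b, ∀ u ∈ S a, ∀ v ∈ S b, u + v ∈ S (a + b)) {a : ℕ} {u : M} (hu : u ∈ S a)
    (m : ℕ) : m • u ∈ S (m * a) := by
  induction m with
  | zero => simpa using h0
  | succ m ih =>
    rw [succ_nsmul, Nat.succ_mul]
    exact hadd _ _ _ ih _ hu

section Semigroup

variable {σ : Type*} [Fintype σ] [DecidableEq σ]

/-- The exponents supported in `T` all of whose coordinates are less than `m`. -/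
def exponentBox (T : Finset σ) (m : ℕ) : Finset (σ →₀ ℕ) :=
  (Fintype.piFinset fun i => if i ∈ T then Finset.range m else {0}).map
    Finsupp.equivFunOnFinite.symm.toEmbedding

theorem mem_exponentBox {T : Finset σ} {m : ℕ} {r : σ →₀ ℕ} :
    r ∈ exponentBox T m ↔ ∀ i, if i ∈ T then r i < m else r i = 0 := by
  simp only [exponentBox, Finset.mem_map_equiv, Fintype.mem_piFinset]
  refine forall_congr' fun i => ?_
  split_ifs <;> simp

theorem card_exponentBox (T : Finset σ) (m : ℕ) : (exponentBox T m).card = m ^ T.card := by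
  rw [exponentBox, Finset.card_map, Fintype.card_piFinset,
    ← Finset.prod_subset (Finset.subset_univ T)]
  · rw [Finset.prod_congr rfl (g := fun _ => m) (fun i hi => by simp [hi])]
    simp
  · intro i _ hi
    simp [hi]

variable {S : ℕ → Set (σ →₀ ℕ)} {T : Finset σ} {K : ℕ}

theorem mem_of_mem_exponentBox (h0 : 0 ∈ S 0) (hmono : Monotone S)
    (hadd : ∀ a b, ∀ u ∈ S a, ∀ v ∈ S b, u + v ∈ S (a + b))
    (hT : ∀ i ∈ T, Finsupp.single i 1 ∈ S K) {m : ℕ} {r : σ →₀ ℕ} (hr : r ∈ exponentBox T m) :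
    r ∈ S (K * T.card * m) := by
  rw [mem_exponentBox] at hr
  have key : ∀ T' ⊆ T, ∑ i ∈ T', r i • Finsupp.single i 1 ∈ S (K * T'.card * m) := by
    intro T'
    induction T' using Finset.induction_on with
    | empty => intro _; simpa using h0
    | insert i T' hi ih =>
      intro hsub
      have hiT : i ∈ T := hsub (Finset.mem_insert_self i T')
      rw [Finset.sum_insert hi, Finset.card_insert_of_notMem hi]
      have h1 := nsmul_mem_of_add_mem h0 hadd (hT i hiT) (r i)
      have h2 := ih ((Finset.subset_insert i T').trans hsub)
      have h3 : r i < m := by simpa [hiT] using hr i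
      refine hmono ?_ (hadd _ _ _ h1 _ h2)
      have : r i * K ≤ m * K := Nat.mul_le_mul_right _ h3.le
      calc r i * K + K * T'.card * m ≤ m * K + K * T'.card * m := by omega
        _ = K * (T'.card + 1) * m := by ring
  have hsum : r = ∑ i ∈ T, r i • Finsupp.single i 1 := by
    rw [Finset.sum_subset (Finset.subset_univ T)]
    · ext j
      simp
    · intro i _ hi
      have := hr i
      simp only [hi, if_false] at this
      simp [this]
  rw [hsum]
  exact key T subset_rfl

/-- If `S` grows at most like `d ^ #T` and contains the unit vectors in the directions of `T`, then
there is no room for further directions. -/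
theorem eq_zero_of_notMem_of_growth (h0 : 0 ∈ S 0) (hmono : Monotone S)
    (hfin : ∀ d, (S d).Finite) (hadd : ∀ a b, ∀ u ∈ S a, ∀ v ∈ S b, u + v ∈ S (a + b))
    (hT : ∀ i ∈ T, Finsupp.single i 1 ∈ S K) {C : ℕ}
    (hbound : ∀ d, 1 ≤ d → (S d).ncard ≤ C * d ^ T.card) {a : ℕ} {v : σ →₀ ℕ} (hv : v ∈ S a)
    {j : σ} (hj : j ∉ T) : v j = 0 := by
  by_contra hvj
  set A := K * T.card + (a + 1) with hA
  set M := C * A ^ T.card + 1 with hM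
  have hsub : (((exponentBox T M ×ˢ Finset.range M).image
      fun p : (σ →₀ ℕ) × ℕ => p.1 + p.2 • v : Finset (σ →₀ ℕ)) : Set (σ →₀ ℕ)) ⊆ S (A * M) := by
    intro w hw
    simp only [Finset.coe_image, Set.mem_image, Finset.mem_coe, Finset.mem_product,
      Finset.mem_range, Prod.exists] at hw
    obtain ⟨r, b, ⟨hr, hb⟩, rfl⟩ := hw
    refine hmono ?_ (hadd _ _ _ (mem_of_mem_exponentBox h0 hmono hadd hT hr) _
      (nsmul_mem_of_add_mem h0 hadd hv b))
    have : b * a ≤ M * (a + 1) := Nat.mul_le_mul hb.le (Nat.le_succ a)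
    calc K * T.card * M + b * a ≤ K * T.card * M + M * (a + 1) := by omega
      _ = A * M := by rw [hA]; ring
  have hcard := Set.ncard_le_ncard hsub (hfin _)
  rw [Set.ncard_coe_finset, Finset.card_image_of_injOn, Finset.card_product, card_exponentBox,
    Finset.card_range] at hcard
  · have h1 := hcard.trans (hbound _ (Nat.mul_pos (by omega) (by omega)))
    rw [mul_pow, ← mul_assoc, mul_comm (M ^ _)] at h1
    have h2 := Nat.le_of_mul_le_mul_right h1 (Nat.pow_pos (by omega))
    omega
  · rintro ⟨r, b⟩ hrb ⟨r', b'⟩ hrb' heq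
    simp only [Finset.coe_product, Set.mem_prod, Finset.mem_coe] at hrb hrb'
    have hz : ∀ r ∈ exponentBox T M, r j = 0 := fun r hr => by
      simpa [hj] using mem_exponentBox.1 hr j
    have hb : b = b' := by
      have := DFunLike.congr_fun heq j
      simp only [Finsupp.add_apply, Finsupp.smul_apply, hz r hrb.1, hz r' hrb'.1, zero_add,
        smul_eq_mul] at this
      exact Nat.eq_of_mul_eq_mul_right (Nat.pos_of_ne_zero hvj) this
    subst hb
    simpa using heq

/-- If `S` grows at most like `d ^ #T` and contains the unit vectors in the directions of `T`, then
its growth is exactly of degree `#T`. The point is that for `u ∈ S d` the whole box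
`m • u + [0, m) ^ T` lies in `S (m * (d + c))`, and these boxes are disjoint for distinct `u`. -/
theorem hasPolynomialGrowth_ncard (h0 : 0 ∈ S 0) (hmono : Monotone S)
    (hfin : ∀ d, (S d).Finite) (hadd : ∀ a b, ∀ u ∈ S a, ∀ v ∈ S b, u + v ∈ S (a + b))
    (hT : ∀ i ∈ T, Finsupp.single i 1 ∈ S K) {C : ℕ}
    (hbound : ∀ d, 1 ≤ d → (S d).ncard ≤ C * d ^ T.card) :
    HasPolynomialGrowth (fun d => (S d).ncard) T.card := by
  refine hasPolynomialGrowth_of_pow_mul_le (c := K * T.card + 1) (C := C) (by omega)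
    (fun a b hab => Set.ncard_le_ncard (hmono hab) (hfin b))
    ((Set.ncard_pos (hfin 0)).2 ⟨0, h0⟩) hbound ?_
  intro m d
  have hsub : (((exponentBox T m ×ˢ (hfin d).toFinset).image
      fun p : (σ →₀ ℕ) × (σ →₀ ℕ) => p.1 + m • p.2 : Finset (σ →₀ ℕ)) : Set (σ →₀ ℕ)) ⊆
      S (m * (d + (K * T.card + 1))) := by
    intro w hw
    simp only [Finset.coe_image, Set.mem_image, Finset.mem_coe, Finset.mem_product,
      Set.Finite.mem_toFinset, Prod.exists] at hw
    obtain ⟨r, u, ⟨hr, hu⟩, rfl⟩ := hw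
    refine hmono ?_ (hadd _ _ _ (mem_of_mem_exponentBox h0 hmono hadd hT hr) _
      (nsmul_mem_of_add_mem h0 hadd hu m))
    calc K * T.card * m + m * d ≤ K * T.card * m + m * d + m := by omega
      _ = m * (d + (K * T.card + 1)) := by ring
  have hcard := Set.ncard_le_ncard hsub (hfin _)
  rw [Set.ncard_coe_finset, Finset.card_image_of_injOn, Finset.card_product, card_exponentBox,
    ← Set.ncard_eq_toFinset_card _ (hfin d)] at hcard
  · exact hcard
  · rintro ⟨r, u⟩ hru ⟨r', u'⟩ hru' heq
    simp only [Finset.coe_product, Set.mem_prod, Finset.mem_coe, Set.Finite.mem_toFinset]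
      at hru hru'
    have hu : u = u' := by
      ext i
      have hi := DFunLike.congr_fun heq i
      simp only [Finsupp.add_apply, Finsupp.smul_apply, smul_eq_mul] at hi
      by_cases hiT : i ∈ T
      · have h1 : r i < m := by simpa [hiT] using mem_exponentBox.1 hru.1 i
        have h2 : r' i < m := by simpa [hiT] using mem_exponentBox.1 hru'.1 i
        have h3 := congrArg (· / m) hi
        have hm : 0 < m := by omega
        simpa [Nat.add_mul_div_left _ _ hm, Nat.div_eq_of_lt h1, Nat.div_eq_of_lt h2] using h3
      · rw [eq_zero_of_notMem_of_growth h0 hmono hfin hadd hT hbound hru.2 hiT,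
          eq_zero_of_notMem_of_growth h0 hmono hfin hadd hT hbound hru'.2 hiT]
    subst hu
    simpa using heq

end Semigroup

/-! ### Initial exponents of power series -/

section InitExp

open scoped MonomialOrder

variable {σ : Type*} {k : Type*} [Field k]

/-- `u` is the initial exponent of the power series `f`: the smallest exponent, for the monomial
order `m`, whose coefficient in `f` does not vanish. -/
def IsInitExp (m : MonomialOrder σ) (f : MvPowerSeries σ k) (u : σ →₀ ℕ) : Prop :=
  MvPowerSeries.coeff u f ≠ 0 ∧ ∀ w, w ≺[m] u → MvPowerSeries.coeff w f = 0

variable {m : MonomialOrder σ}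

theorem exists_isInitExp {f : MvPowerSeries σ k} (hf : f ≠ 0) : ∃ u, IsInitExp m f u := by
  obtain ⟨u, hu⟩ : ∃ u, MvPowerSeries.coeff u f ≠ 0 := by
    by_contra! h
    exact hf (MvPowerSeries.ext h)
  obtain ⟨_, ⟨v, hv, rfl⟩, hmin⟩ := (wellFounded_lt (α := m.syn)).has_min
    (m.toSyn '' {u | MvPowerSeries.coeff u f ≠ 0}) ⟨_, u, hu, rfl⟩
  refine ⟨v, hv, fun w hw => ?_⟩
  by_contra hne
  exact hmin _ ⟨w, hne, rfl⟩ hw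

theorem IsInitExp.mul {f g : MvPowerSeries σ k} {u v : σ →₀ ℕ} (hf : IsInitExp m f u)
    (hg : IsInitExp m g v) : IsInitExp m (f * g) (u + v) := by
  classical
  constructor
  · rw [MvPowerSeries.coeff_mul, Finset.sum_eq_single (u, v)]
    · exact mul_ne_zero hf.1 hg.1
    · rintro ⟨a, b⟩ hab hne
      rw [Finset.HasAntidiagonal.mem_antidiagonal] at hab
      rcases lt_trichotomy (m.toSyn a) (m.toSyn u) with h | h | h
      · simp [hf.2 a h]
      · have ha : a = u := m.toSyn.injective h
        subst ha
        exact absurd (by simpa using hab) (fun hb : b = v => hne (by rw [hb]))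
      · have hb : b ≺[m] v := by
          by_contra hb
          have h1 : m.toSyn (a + b) = m.toSyn (u + v) := by rw [hab]
          rw [map_add, map_add] at h1
          exact absurd h1 (add_lt_add_of_lt_of_le h (not_lt.1 hb)).ne'
        simp [hg.2 b hb]
    · intro h
      exact absurd (by simp) h
  · intro w hw
    rw [MvPowerSeries.coeff_mul]
    refine Finset.sum_eq_zero ?_
    rintro ⟨a, b⟩ hab
    rw [Finset.HasAntidiagonal.mem_antidiagonal] at hab
    by_cases ha : a ≺[m] u
    · simp [hf.2 a ha]
    · have hb : b ≺[m] v := by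
        by_contra hb
        have h1 : m.toSyn (a + b) < m.toSyn (u + v) := by rwa [hab]
        rw [map_add, map_add] at h1
        exact absurd h1 (not_lt.2 (add_le_add (not_lt.1 ha) (not_lt.1 hb)))
      simp [hg.2 b hb]

theorem isInitExp_one : IsInitExp m (1 : MvPowerSeries σ k) 0 := by
  classical
  refine ⟨by simp, fun w hw => ?_⟩
  rw [MvPowerSeries.coeff_one, if_neg]
  rintro rfl
  exact lt_irrefl _ hw

theorem IsInitExp.pow {f : MvPowerSeries σ k} {u : σ →₀ ℕ} (hf : IsInitExp m f u) (n : ℕ) :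
    IsInitExp m (f ^ n) (n • u) := by
  induction n with
  | zero => simpa using isInitExp_one
  | succ n ih =>
    rw [pow_succ, succ_nsmul]
    exact ih.mul hf

theorem isInitExp_prod {ι : Type*} (s : Finset ι) {f : ι → MvPowerSeries σ k} {u : ι → σ →₀ ℕ}
    (h : ∀ i ∈ s, IsInitExp m (f i) (u i)) : IsInitExp m (∏ i ∈ s, f i) (∑ i ∈ s, u i) := by
  classical
  induction s using Finset.induction_on with
  | empty => simpa using isInitExp_one
  | insert i s hi ih =>
    rw [Finset.prod_insert hi, Finset.sum_insert hi]
    exact (h i (Finset.mem_insert_self i s)).mul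
      (ih fun j hj => h j (Finset.mem_insert_of_mem hj))

/-- If each `f i` has the unit vector `i` as its initial exponent, then the monomial with exponent
`u` in the `f i` has initial exponent `u`. -/
theorem isInitExp_monomial {f : σ → MvPowerSeries σ k}
    (h : ∀ i, IsInitExp m (f i) (Finsupp.single i 1)) (u : σ →₀ ℕ) :
    IsInitExp m (u.prod fun i n => f i ^ n) u := by
  have := isInitExp_prod u.support fun i _ => (h i).pow (u i)
  have hu : ∑ i ∈ u.support, u i • Finsupp.single i 1 = u := by
    conv_rhs => rw [← Finsupp.sum_single u]
    simp [Finsupp.sum]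
  rwa [hu] at this

/-- The initial exponent of a linear combination of series with distinct initial exponents is the
smallest of those that occur. -/
theorem coeff_sum_ne_zero {ι : Type*} {f : ι → MvPowerSeries σ k} {u : ι → σ →₀ ℕ}
    (hu : Function.Injective u) (h : ∀ i, IsInitExp m (f i) (u i)) {s : Finset ι} {c : ι → k}
    (hc : ∃ i ∈ s, c i ≠ 0) :
    ∃ i ∈ s, MvPowerSeries.coeff (u i) (∑ j ∈ s, c j • f j) ≠ 0 := by
  classical
  obtain ⟨i₀, hi₀, hci₀⟩ := hc
  obtain ⟨i, hi, hmin⟩ := (s.filter fun i => c i ≠ 0).exists_min_image (fun i => m.toSyn (u i))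
    ⟨i₀, by simp [hi₀, hci₀]⟩
  rw [Finset.mem_filter] at hi
  refine ⟨i, hi.1, ?_⟩
  rw [map_sum, Finset.sum_eq_single i]
  · simpa using ⟨hi.2, (h i).1⟩
  · intro j hj hji
    by_cases hcj : c j = 0
    · simp [hcj]
    · have h1 := hmin j (by simp [hj, hcj])
      have h2 : u i ≺[m] u j := lt_of_le_of_ne h1 fun he =>
        hji (hu (m.toSyn.injective he)).symm
      simp [(h j).2 _ h2]
  · intro h'
    exact absurd hi.1 h'

theorem linearIndependent_of_isInitExp {ι : Type*} {f : ι → MvPowerSeries σ k} {u : ι → σ →₀ ℕ}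
    (hu : Function.Injective u) (h : ∀ i, IsInitExp m (f i) (u i)) : LinearIndependent k f := by
  rw [linearIndependent_iff']
  intro s c hsum
  by_contra! hc
  obtain ⟨i, _, hi⟩ := coeff_sum_ne_zero hu h hc
  rw [hsum] at hi
  exact hi (map_zero _)

variable {A : Type*} [AddCommGroup A] [Module k A]

/-- The initial exponents of the elements of a subspace `W`, viewed in the power series ring. -/
def initExps (m : MonomialOrder σ) (ψ : A →ₗ[k] MvPowerSeries σ k) (W : Submodule k A) :
    Set (σ →₀ ℕ) :=
  {u | ∃ f ∈ W, IsInitExp m (ψ f) u}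

theorem finite_initExps (ψ : A →ₗ[k] MvPowerSeries σ k) (W : Submodule k A)
    [Module.Finite k W] : (initExps m ψ W).Finite := by
  choose f hfW hf using fun u : initExps m ψ W => u.2
  have hli : LinearIndependent k (fun u => (⟨f u, hfW u⟩ : W)) := by
    refine LinearIndependent.of_comp (ψ ∘ₗ W.subtype) ?_
    exact linearIndependent_of_isInitExp Subtype.val_injective hf
  have : Finite (initExps m ψ W) := hli.finite
  exact Set.toFinite _

/-- Initial exponents have one-dimensional leaves, so that counting them gives the dimension. -/
theorem finrank_eq_ncard_initExps (ψ : A →ₗ[k] MvPowerSeries σ k) (hψ : Function.Injective ψ)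
    (W : Submodule k A) [Module.Finite k W] :
    Module.finrank k W = (initExps m ψ W).ncard := by
  have hfin := finite_initExps (m := m) ψ W
  have : Fintype (initExps m ψ W) := hfin.fintype
  choose f hfW hf using fun u : initExps m ψ W => u.2
  have hli : LinearIndependent k (fun u => (⟨f u, hfW u⟩ : W)) := by
    refine LinearIndependent.of_comp (ψ ∘ₗ W.subtype) ?_
    exact linearIndependent_of_isInitExp Subtype.val_injective hf
  rw [← Nat.card_coe_set_eq, Nat.card_eq_fintype_card]
  refine le_antisymm ?_ hli.fintype_card_le_finrank
  let L : W →ₗ[k] (initExps m ψ W → k) :=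
    LinearMap.pi fun u => MvPowerSeries.coeff u.1 ∘ₗ ψ ∘ₗ W.subtype
  have hL : Function.Injective L := by
    rw [← LinearMap.ker_eq_bot, LinearMap.ker_eq_bot']
    intro w hw
    by_contra hne
    have h0 : ψ w ≠ 0 := fun h => hne (Subtype.ext (hψ (by simpa using h)))
    obtain ⟨u, hu⟩ := exists_isInitExp (m := m) h0
    exact hu.1 (congrFun hw ⟨u, w, w.2, hu⟩)
  simpa using LinearMap.finrank_le_finrank_of_injective hL

end InitExp

/-- The growth criterion: if a multiplicative filtration `W` of an algebra embedded in a power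
series ring contains elements with initial exponents the unit vectors in the directions of `T`, and
`W` grows at most like `d ^ #T`, then it grows exactly so. -/
theorem hasPolynomialGrowth_finrank {σ k A : Type*} [Field k] [CommRing A] [Algebra k A] [Fintype σ]
    [DecidableEq σ] {m : MonomialOrder σ} (ψ : A →ₐ[k] MvPowerSeries σ k)
    (hψ : Function.Injective ψ) {W : ℕ → Submodule k A} (hone : 1 ∈ W 0) (hmono : Monotone W)
    (hmul : ∀ a b, ∀ x ∈ W a, ∀ y ∈ W b, x * y ∈ W (a + b)) [∀ d, Module.Finite k (W d)]
    {T : Finset σ} {K : ℕ} (hT : ∀ i ∈ T, ∃ x ∈ W K, IsInitExp m (ψ x) (Finsupp.single i 1))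
    {C : ℕ} (hbound : ∀ d, 1 ≤ d → Module.finrank k (W d) ≤ C * d ^ T.card) :
    HasPolynomialGrowth (fun d => Module.finrank k (W d)) T.card := by
  have hrank : ∀ d, Module.finrank k (W d) = (initExps m ψ.toLinearMap (W d)).ncard := fun d =>
    finrank_eq_ncard_initExps _ hψ _
  simp_rw [hrank] at hbound ⊢
  refine hasPolynomialGrowth_ncard (S := fun d => initExps m ψ.toLinearMap (W d)) (K := K)
    ⟨1, hone, by simpa using isInitExp_one⟩ (fun a b hab u => ?_) (fun d => finite_initExps _ _) ?_
    hT hbound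
  · rintro ⟨f, hf, hu⟩
    exact ⟨f, hmono hab hf, hu⟩
  · rintro a b u ⟨f, hf, hu⟩ v ⟨g, hg, hv⟩
    refine ⟨f * g, hmul a b f hf g hg, ?_⟩
    simpa using IsInitExp.mul hu hv

/-! ### Formal coordinates at a rational point of a smooth algebra -/

theorem isAdicComplete_pow {R : Type*} [CommRing R] (I : Ideal R) [IsAdicComplete I R] {p : ℕ}
    (hp : 0 < p) : IsAdicComplete (I ^ p) R := by
  have hle : ∀ n : ℕ, ((I ^ p) ^ n • ⊤ : Ideal R) ≤ (I ^ n • ⊤ : Ideal R) := fun n => by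
    rw [← pow_mul]
    exact Submodule.smul_mono_left (Ideal.pow_le_pow_right (Nat.le_mul_of_pos_left n hp))
  have h1 : IsHausdorff (I ^ p) R :=
    ⟨fun x hx => IsHausdorff.haus (I := I) inferInstance x fun n => (hx n).mono (hle n)⟩
  have h2 : IsPrecomplete (I ^ p) R := by
    refine ⟨fun f hf => ?_⟩
    obtain ⟨L, hL⟩ := IsPrecomplete.prec (I := I) (M := R) inferInstance (f := f)
      fun {m n} hmn => (hf hmn).mono (hle m)
    refine ⟨L, fun n => ?_⟩
    have h := hL (p * n)
    rw [pow_mul] at h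
    exact (hf (Nat.le_mul_of_pos_left n hp)).trans h
  exact { h1, h2 with }

section Coordinates

variable {σ k A : Type*} [Field k] [CommRing A] [Algebra k A]

/-- The functions `x i` form a system of coordinates at the rational point `ε`: they vanish there
and their classes form a basis of the cotangent space `m / m ^ 2`, where `m = ker ε`. Linear
independence is expressed by a dual family of tangent vectors, that is, of point derivations. -/
structure IsCoordinateSystem (ε : A →ₐ[k] k) (x : σ → A) : Prop where
  apply_eq_zero : ∀ i, ε (x i) = 0
  ker_le : RingHom.ker ε ≤ Ideal.span (Set.range x) ⊔ RingHom.ker ε ^ 2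
  exists_dual : ∃ D : σ → A →ₗ[k] k, (∀ i a b, D i (a * b) = ε a * D i b + ε b * D i a) ∧
    (∀ i, D i (x i) = 1) ∧ ∀ i j, i ≠ j → D i (x j) = 0

/-- The class of `a - a(ε)` in the cotangent space at `ε`. -/
def cotangentClass (ε : A →ₐ[k] k) : A →ₗ[k] (RingHom.ker ε).Cotangent where
  toFun a := (RingHom.ker ε).toCotangent ⟨a - algebraMap k A (ε a), by simp [RingHom.mem_ker]⟩
  map_add' a b := by
    rw [← map_add]
    congr 1
    ext
    simp only [map_add, AddMemClass.mk_add_mk]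
    ring
  map_smul' c a := by
    rw [RingHom.id_apply, ← LinearMap.map_smul_of_tower]
    congr 1
    ext
    simp [Algebra.smul_def, mul_sub]

theorem cotangentClass_of_mem (ε : A →ₐ[k] k) {a : A} (ha : a ∈ RingHom.ker ε) :
    cotangentClass ε a = (RingHom.ker ε).toCotangent ⟨a, ha⟩ := by
  have : ε a = 0 := ha
  simp only [cotangentClass, LinearMap.coe_mk, AddHom.coe_mk]
  congr 2
  simp [this]

theorem cotangentClass_mul (ε : A →ₐ[k] k) (a b : A) :
    cotangentClass ε (a * b) = ε a • cotangentClass ε b + ε b • cotangentClass ε a := by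
  simp only [cotangentClass, LinearMap.coe_mk, AddHom.coe_mk]
  rw [← LinearMap.map_smul_of_tower, ← LinearMap.map_smul_of_tower, ← map_add,
    Ideal.toCotangent_eq]
  have : (a * b - algebraMap k A (ε (a * b))) -
      (ε a • (b - algebraMap k A (ε b)) + ε b • (a - algebraMap k A (ε a))) =
      (a - algebraMap k A (ε a)) * (b - algebraMap k A (ε b)) := by
    simp only [map_mul, Algebra.smul_def]
    ring
  simp only [Submodule.coe_add, Submodule.coe_smul_of_tower]
  rw [this, pow_two]
  exact Ideal.mul_mem_mul (by simp [RingHom.mem_ker]) (by simp [RingHom.mem_ker])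

theorem isCoordinateSystem_of_basis [Finite σ] {ε : A →ₐ[k] k} {x : σ → A}
    (b : Module.Basis σ k (RingHom.ker ε).Cotangent) (hx : ∀ i, ε (x i) = 0)
    (hb : ∀ i, cotangentClass ε (x i) = b i) : IsCoordinateSystem ε x := by
  cases nonempty_fintype σ
  refine ⟨hx, fun y hy => ?_, fun i => b.coord i ∘ₗ cotangentClass ε, ?_, ?_, ?_⟩
  · set z := ∑ i, b.repr (cotangentClass ε y) i • x i with hz
    have hzspan : z ∈ Ideal.span (Set.range x) := Submodule.sum_mem _ fun i _ =>
      Submodule.smul_of_tower_mem _ _ (Ideal.subset_span ⟨i, rfl⟩)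
    have hzker : z ∈ RingHom.ker ε := by
      rw [RingHom.mem_ker, hz, map_sum]
      simp [hx]
    have h : cotangentClass ε z = cotangentClass ε y := by
      rw [hz, map_sum]
      simp only [map_smul, hb]
      exact b.sum_repr _
    rw [cotangentClass_of_mem ε hy, cotangentClass_of_mem ε hzker, Ideal.toCotangent_eq] at h
    have hy' : y = z + -(z - y) := by ring
    rw [hy']
    exact Submodule.add_mem_sup hzspan (neg_mem h)
  · intro i a a'
    simp [cotangentClass_mul]
  · intro i
    simp [hb]
  · intro i j hij
    simp [hb, hij.symm]

theorem le_order_of_mem_span_X_pow {f : MvPowerSeries σ k} {j : ℕ}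
    (hf : f ∈ Ideal.span (Set.range (MvPowerSeries.X : σ → MvPowerSeries σ k)) ^ j) :
    (j : ℕ∞) ≤ f.order := by
  induction j generalizing f with
  | zero => simp
  | succ j ih =>
    rw [pow_succ] at hf
    refine Submodule.mul_induction_on hf (fun a ha b hb => ?_) fun a b ha hb =>
      (le_min ha hb).trans MvPowerSeries.min_order_le_add
    refine le_trans ?_ MvPowerSeries.le_order_mul
    have hb1 : (1 : ℕ∞) ≤ b.order := by
      rw [MvPowerSeries.one_le_order_iff_constCoeff_eq_zero]
      have : Ideal.span (Set.range (MvPowerSeries.X : σ → MvPowerSeries σ k)) ≤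
          RingHom.ker (MvPowerSeries.constantCoeff (σ := σ) (R := k)) := by
        rw [Ideal.span_le]
        rintro _ ⟨i, rfl⟩
        simp [RingHom.mem_ker]
      exact this hb
    push_cast
    exact add_le_add (ih ha) hb1

/-- A coordinate system at a rational point of a smooth algebra extends to a homomorphism to the
power series ring that sends the coordinates to series with the variables as initial terms: the
homomorphism to `k[[t]] / (t) ^ 2` given by the dual tangent vectors lifts by formal smoothness. -/
theorem IsCoordinateSystem.exists_algHom [LinearOrder σ] [Fintype σ]
    [Algebra.FormallySmooth k A] {ε : A →ₐ[k] k} {x : σ → A}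
    (hx : IsCoordinateSystem ε x) : ∃ ψ : A →ₐ[k] MvPowerSeries σ k,
      (∀ a, MvPowerSeries.constantCoeff (ψ a) = ε a) ∧
      ∀ i, IsInitExp MonomialOrder.degLex (ψ (x i)) (Finsupp.single i 1) := by
  classical
  obtain ⟨D, hD, hD1, hD0⟩ := hx.exists_dual
  set I : Ideal (MvPowerSeries σ k) := Ideal.span (Set.range MvPowerSeries.X) with hI
  have hcomplete : IsAdicComplete (I ^ 2) (MvPowerSeries σ k) := isAdicComplete_pow I two_pos
  have hX : ∀ i, (MvPowerSeries.X i : MvPowerSeries σ k) ∈ I := fun i =>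
    Ideal.subset_span ⟨i, rfl⟩
  have hD_one : ∀ i, D i 1 = 0 := fun i => by simpa using hD i 1 1
  let lin : A →ₗ[k] MvPowerSeries σ k :=
    ∑ i, (LinearMap.toSpanSingleton k (MvPowerSeries σ k) (MvPowerSeries.X i)) ∘ₗ D i
  have hlin : ∀ a, lin a = ∑ i, D i a • (MvPowerSeries.X i : MvPowerSeries σ k) := fun a => by
    simp [lin]
  have hlinI : ∀ a, lin a ∈ I := fun a => by
    rw [hlin]
    exact Submodule.sum_mem _ fun i _ => Submodule.smul_of_tower_mem _ _ (hX i)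
  let L : A →ₗ[k] MvPowerSeries σ k := Algebra.linearMap k _ ∘ₗ ε.toLinearMap + lin
  have hL : ∀ a, L a = algebraMap k _ (ε a) + lin a := fun a => rfl
  have hlin_mul : ∀ a b, lin (a * b) = ε a • lin b + ε b • lin a := fun a b => by
    simp only [hlin, hD, add_smul, Finset.sum_add_distrib, Finset.smul_sum, mul_smul]
  let f : A →ₐ[k] MvPowerSeries σ k ⧸ I ^ 2 := AlgHom.ofLinearMap
    ((Ideal.Quotient.mkₐ k (I ^ 2)).toLinearMap ∘ₗ L)
    (by
      change Ideal.Quotient.mk (I ^ 2) (L 1) = 1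
      rw [hL, hlin]
      simp [hD_one])
    (by
      intro a b
      change Ideal.Quotient.mk (I ^ 2) (L (a * b)) =
        Ideal.Quotient.mk (I ^ 2) (L a) * Ideal.Quotient.mk (I ^ 2) (L b)
      rw [← map_mul, eq_comm, Ideal.Quotient.eq]
      have : L a * L b - L (a * b) = lin a * lin b := by
        rw [hL, hL, hL, hlin_mul, map_mul, map_mul, Algebra.smul_def, Algebra.smul_def]
        ring
      rw [this, pow_two]
      exact Ideal.mul_mem_mul (hlinI a) (hlinI b))
  obtain ⟨ψ, hψ⟩ := Algebra.FormallySmooth.exists_mkₐ_comp_eq_of_isAdicComplete f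
  have hsub : ∀ a, ((2 : ℕ) : ℕ∞) ≤ (ψ a - L a).order := fun a => by
    apply le_order_of_mem_span_X_pow
    rw [← Ideal.Quotient.eq]
    exact DFunLike.congr_fun hψ a
  have hcoeff : ∀ a (w : σ →₀ ℕ), w.degree < 2 →
      MvPowerSeries.coeff w (ψ a) = MvPowerSeries.coeff w (L a) := fun a w hw => by
    rw [← sub_eq_zero, ← map_sub]
    exact MvPowerSeries.coeff_of_lt_order (lt_of_lt_of_le (by exact_mod_cast hw) (hsub a))
  have hconst : ∀ a, MvPowerSeries.coeff 0 (ψ a) = ε a := fun a => by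
    rw [hcoeff a 0 (by simp), hL, hlin]
    simp [MvPowerSeries.algebraMap_apply]
  have hcoeff1 : ∀ a j, MvPowerSeries.coeff (Finsupp.single j 1) (ψ a) = D j a := fun a j => by
    rw [hcoeff a _ (by simp), hL, hlin, map_add, map_sum, Finset.sum_eq_single j]
    · simp [MvPowerSeries.algebraMap_apply, MvPowerSeries.coeff_C]
    · intro i _ hij
      simp [MvPowerSeries.coeff_X, Finsupp.single_left_inj, hij.symm]
    · simp
  refine ⟨ψ, fun a => by simpa using hconst a, fun i => ⟨?_, fun w hw => ?_⟩⟩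
  · rw [hcoeff1, hD1]
    exact one_ne_zero
  · rw [MonomialOrder.degLex_lt_iff, Finsupp.DegLex.lt_iff] at hw
    simp only [ofDegLex_toDegLex, Finsupp.degree_single] at hw
    have hle : w.degree ≤ 1 := by omega
    rcases Nat.le_one_iff_eq_zero_or_eq_one.1 hle with h0 | h1
    · rw [Finsupp.degree_eq_zero_iff] at h0
      rw [h0, hconst, hx.apply_eq_zero]
    · obtain ⟨j, rfl⟩ : w ∈ Set.range fun j : σ => Finsupp.single j 1 := by
        rw [Finsupp.range_single_one]
        exact h1
      rw [hcoeff1]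
      refine hD0 _ _ ?_
      rintro rfl
      simp at hw

/-- The monomial of exponent `u` in the functions `x i`. -/
def monomialIn {R : Type*} [CommRing R] (x : σ → R) (u : σ →₀ ℕ) : R :=
  u.prod fun i n => x i ^ n

theorem monomialIn_add {R : Type*} [CommRing R] (x : σ → R) (u v : σ →₀ ℕ) :
    monomialIn x (u + v) = monomialIn x u * monomialIn x v :=
  Finsupp.prod_add_index' (fun _ => pow_zero _) fun _ _ _ => pow_add _ _ _

theorem map_monomialIn {R S F : Type*} [CommRing R] [CommRing S] [FunLike F R S]
    [RingHomClass F R S] (f : F) (x : σ → R) (u : σ →₀ ℕ) :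
    f (monomialIn x u) = monomialIn (fun i => f (x i)) u := by
  simp [monomialIn, Finsupp.prod]

/-- Modulo `m ^ (j + 1)`, the power `m ^ j` is spanned by the monomials of degree `j`. -/
theorem IsCoordinateSystem.ker_pow_le {ε : A →ₐ[k] k} {x : σ → A} (hx : IsCoordinateSystem ε x)
    (j : ℕ) {a : A} (ha : a ∈ RingHom.ker ε ^ j) :
    ∃ s ∈ Submodule.span k (Set.range fun u : {u : σ →₀ ℕ // u.degree = j} => monomialIn x u.1),
      a - s ∈ RingHom.ker ε ^ (j + 1) := by
  have hx' : ∀ i, x i ∈ RingHom.ker ε := hx.apply_eq_zero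
  have hdeg1 : ∀ b ∈ RingHom.ker ε, ∃ s ∈ Submodule.span k (Set.range x),
      b - s ∈ RingHom.ker ε ^ 2 := by
    intro b hb
    obtain ⟨y, hy, z, hz, rfl⟩ := Submodule.mem_sup.1 (hx.ker_le hb)
    have key : ∀ y ∈ Ideal.span (Set.range x), ∃ s ∈ Submodule.span k (Set.range x),
        y - s ∈ RingHom.ker ε ^ 2 := by
      intro y hy
      induction hy using Submodule.span_induction with
      | mem y hy => exact ⟨y, Submodule.subset_span hy, by simp⟩
      | zero => exact ⟨0, zero_mem _, by simp⟩
      | add y y' _ _ h h' =>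
        obtain ⟨s, hs, hys⟩ := h
        obtain ⟨s', hs', hys'⟩ := h'
        exact ⟨s + s', add_mem hs hs', by rw [add_sub_add_comm]; exact add_mem hys hys'⟩
      | smul c y hy h =>
        obtain ⟨s, hs, hys⟩ := h
        refine ⟨ε c • s, Submodule.smul_mem _ _ hs, ?_⟩
        have hyker : y ∈ RingHom.ker ε :=
          (Ideal.span_le.2 (by rintro _ ⟨i, rfl⟩; exact hx' i) :
            Ideal.span (Set.range x) ≤ RingHom.ker ε) hy
        have : c • y - ε c • s = (c - algebraMap k A (ε c)) * y +
            algebraMap k A (ε c) * (y - s) := by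
          rw [smul_eq_mul, Algebra.smul_def]
          ring
        rw [this]
        refine add_mem ?_ (Ideal.mul_mem_left _ _ hys)
        rw [pow_two]
        exact Ideal.mul_mem_mul (by simp [RingHom.mem_ker]) hyker
    obtain ⟨s, hs, hys⟩ := key y hy
    exact ⟨s, hs, by rw [add_sub_right_comm]; exact add_mem hys hz⟩
  induction j generalizing a with
  | zero =>
    refine ⟨algebraMap k A (ε a), ?_, by simp [RingHom.mem_ker]⟩
    rw [Algebra.algebraMap_eq_smul_one]
    refine Submodule.smul_mem _ _ (Submodule.subset_span ⟨⟨0, by simp⟩, ?_⟩)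
    simp [monomialIn]
  | succ j ih =>
    rw [pow_succ] at ha
    refine Submodule.mul_induction_on ha (fun a ha b hb => ?_) ?_
    · obtain ⟨s, hs, has⟩ := ih ha
      obtain ⟨t, ht, hbt⟩ := hdeg1 b hb
      have hsker : s ∈ RingHom.ker ε ^ j := by
        have : s = a - (a - s) := by ring
        rw [this]
        exact sub_mem ha (Ideal.pow_le_pow_right (Nat.le_succ j) has)
      refine ⟨s * t, ?_, ?_⟩
      · have hst := Submodule.mul_mem_mul hs ht
        rw [Submodule.span_mul_span] at hst
        refine Submodule.span_mono ?_ hst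
        rintro _ ⟨_, ⟨⟨u, hu⟩, rfl⟩, _, ⟨i, rfl⟩, rfl⟩
        refine ⟨⟨u + Finsupp.single i 1, by simp [hu]⟩, ?_⟩
        simp only [monomialIn_add]
        simp [monomialIn]
      · have : a * b - s * t = (a - s) * b + s * (b - t) := by ring
        rw [this]
        refine add_mem ?_ ?_
        · rw [pow_succ]
          exact Ideal.mul_mem_mul has hb
        · have h := Ideal.mul_mem_mul hsker hbt
          rwa [← pow_add] at h
    · rintro a b ⟨s, hs, has⟩ ⟨t, ht, hbt⟩
      exact ⟨s + t, add_mem hs ht, by rw [add_sub_add_comm]; exact add_mem has hbt⟩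

/-- A homomorphism to power series as in `IsCoordinateSystem.exists_algHom` induces an injection on
the associated graded rings, so its kernel lies in all powers of `m`. -/
theorem IsCoordinateSystem.mem_ker_pow_of_map_eq_zero {ε : A →ₐ[k] k} {x : σ → A}
    (hx : IsCoordinateSystem ε x) {m : MonomialOrder σ} {ψ : A →ₐ[k] MvPowerSeries σ k}
    (hε : ∀ a, MvPowerSeries.constantCoeff (ψ a) = ε a)
    (hψ : ∀ i, IsInitExp m (ψ (x i)) (Finsupp.single i 1)) {a : A} (ha : ψ a = 0) (j : ℕ) :
    a ∈ RingHom.ker ε ^ j := by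
  have horder : ∀ (j : ℕ) (b : A), b ∈ RingHom.ker ε ^ j → (j : ℕ∞) ≤ (ψ b).order := by
    intro j
    induction j with
    | zero => simp
    | succ j ih =>
      intro b hb
      rw [pow_succ] at hb
      refine Submodule.mul_induction_on hb (fun a ha b hb => ?_) fun a b ha hb => ?_
      · rw [map_mul]
        refine le_trans ?_ MvPowerSeries.le_order_mul
        push_cast
        refine add_le_add (ih a ha) ?_
        rw [MvPowerSeries.one_le_order_iff_constCoeff_eq_zero, hε]
        exact hb
      · rw [map_add]
        exact (le_min ha hb).trans MvPowerSeries.min_order_le_add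
  induction j with
  | zero => simp
  | succ j ih =>
    obtain ⟨s, hs, has⟩ := hx.ker_pow_le j ih
    obtain ⟨c, rfl⟩ := (Finsupp.mem_span_range_iff_exists_finsupp).1 hs
    suffices hc : c = 0 by simpa [hc] using has
    by_contra hc
    obtain ⟨i, hi⟩ := Finsupp.support_nonempty_iff.2 hc
    have hmon : ∀ u : {u : σ →₀ ℕ // u.degree = j}, IsInitExp m (ψ (monomialIn x u.1)) u.1 :=
      fun u => by
        rw [map_monomialIn]
        exact isInitExp_monomial hψ u.1
    obtain ⟨u, _, hu⟩ := coeff_sum_ne_zero Subtype.val_injective hmon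
      (s := c.support) (c := c) ⟨i, hi, Finsupp.mem_support_iff.1 hi⟩
    apply hu
    have h1 := MvPowerSeries.coeff_of_lt_order (d := u.1)
      (lt_of_lt_of_le (by rw [u.2]; exact_mod_cast Nat.lt_succ_self j) (horder _ _ has))
    rw [map_sub, ha, zero_sub, map_neg, neg_eq_zero] at h1
    simpa [Finsupp.sum] using h1

end Coordinates

/-! ### Contractions of tensors -/

section Contraction

variable {k V W : Type*} [Field k] [AddCommGroup V] [Module k V] [AddCommGroup W] [Module k W]

/-- The contraction `id ⊗ μ : V ⊗ W → V` with a functional on the right factor. -/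
def tensorContractRight (μ : W →ₗ[k] k) : V ⊗[k] W →ₗ[k] V :=
  (TensorProduct.rid k V).toLinearMap ∘ₗ LinearMap.lTensor V μ

/-- The contraction `μ ⊗ id : V ⊗ W → W` with a functional on the left factor. -/
def tensorContractLeft (μ : V →ₗ[k] k) : V ⊗[k] W →ₗ[k] W :=
  (TensorProduct.lid k W).toLinearMap ∘ₗ LinearMap.rTensor W μ

@[simp]
theorem tensorContractRight_tmul (μ : W →ₗ[k] k) (v : V) (w : W) :
    tensorContractRight μ (v ⊗ₜ[k] w) = μ w • v := by
  simp [tensorContractRight]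

@[simp]
theorem tensorContractLeft_tmul (μ : V →ₗ[k] k) (v : V) (w : W) :
    tensorContractLeft μ (v ⊗ₜ[k] w) = μ v • w := by
  simp [tensorContractLeft]

theorem apply_tensorContractRight (μ : V →ₗ[k] k) (ν : W →ₗ[k] k) (z : V ⊗[k] W) :
    μ (tensorContractRight ν z) = ν (tensorContractLeft μ z) := by
  induction z with
  | zero => simp
  | tmul v w => simp [mul_comm]
  | add z z' h h' => simp [h, h']

theorem eq_sum_tensorContractRight_tmul {ι : Type*} (b : Module.Basis ι k W) (z : V ⊗[k] W) :
    ∃ s : Finset ι, z = ∑ i ∈ s, tensorContractRight (b.coord i) z ⊗ₜ[k] b i := by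
  classical
  obtain ⟨c, hc⟩ := TensorProduct.eq_repr_basis_right b z
  refine ⟨c.support, ?_⟩
  conv_lhs => rw [← hc]
  refine Finset.sum_congr rfl fun i _ => ?_
  congr 1
  rw [← hc, Finsupp.sum, map_sum]
  by_cases hi : i ∈ c.support
  · rw [Finset.sum_eq_single i]
    · simp
    · intro j _ hj
      simp [hj]
    · exact fun h => absurd hi h
  · rw [Finset.sum_eq_zero, Finsupp.notMem_support_iff.1 hi]
    intro j hj
    have : j ≠ i := fun h => hi (h ▸ hj)
    simp [this]

theorem eq_zero_of_tensorContractRight_eq_zero {z : V ⊗[k] W}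
    (h : ∀ μ : W →ₗ[k] k, tensorContractRight μ z = 0) : z = 0 := by
  obtain ⟨s, hs⟩ := eq_sum_tensorContractRight_tmul (Module.Basis.ofVectorSpace k W) z
  rw [hs]
  exact Finset.sum_eq_zero fun i _ => by rw [h, TensorProduct.zero_tmul]

end Contraction

/-! ### The convolution group of points of an affine group scheme -/

section PointMul

variable {k : Type u} [Field k] {A : Type u} [CommRing A] [HopfAlgebra k A]
  {R : Type u} [CommRing R] [Algebra k R]

theorem toConv_pointMul (g g' : A →ₐ[k] R) :
    WithConv.toConv (pointMul g g') = WithConv.toConv g * WithConv.toConv g' := by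
  ext a
  rw [AlgHom.convMul_apply]
  rfl

/-- The inverse of a point. -/
def pointInv (g : A →ₐ[k] R) : A →ₐ[k] R :=
  g.comp (HopfAlgebra.antipodeAlgHom k A)

/-- The identity element among the points. -/
def pointOne (R : Type u) [CommRing R] [Algebra k R] : A →ₐ[k] R :=
  (Algebra.ofId k R).comp (Bialgebra.counitAlgHom k A)

theorem toConv_pointOne : WithConv.toConv (pointOne R : A →ₐ[k] R) = 1 := rfl

theorem pointMul_assoc (f g h : A →ₐ[k] R) :
    pointMul (pointMul f g) h = pointMul f (pointMul g h) := by
  apply WithConv.toConv_injective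
  simp only [toConv_pointMul, mul_assoc]

@[simp]
theorem pointMul_pointOne (g : A →ₐ[k] R) : pointMul g (pointOne R) = g := by
  apply WithConv.toConv_injective
  rw [toConv_pointMul, toConv_pointOne, mul_one]

@[simp]
theorem pointOne_pointMul (g : A →ₐ[k] R) : pointMul (pointOne R) g = g := by
  apply WithConv.toConv_injective
  rw [toConv_pointMul, toConv_pointOne, one_mul]

theorem comp_pointMul {R' : Type u} [CommRing R'] [Algebra k R'] (f : R →ₐ[k] R')
    (g h : A →ₐ[k] R) : f.comp (pointMul g h) = pointMul (f.comp g) (f.comp h) := by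
  rw [pointMul, pointMul, ← AlgHom.comp_assoc]
  congr 1
  ext <;> simp

theorem comp_pointOne {R' : Type u} [CommRing R'] [Algebra k R'] (f : R →ₐ[k] R') :
    f.comp (pointOne R : A →ₐ[k] R) = pointOne R' := by
  ext a
  simp [pointOne]

theorem pointMul_pointInv (g : A →ₐ[k] R) : pointMul g (pointInv g) = pointOne R := by
  have h : pointMul (AlgHom.id k A) (pointInv (AlgHom.id k A)) = pointOne A := by
    apply WithConv.toConv_injective
    rw [toConv_pointMul]
    exact mul_inv_cancel (WithConv.toConv (AlgHom.id k A))
  have h2 := congrArg g.comp h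
  rwa [comp_pointMul, comp_pointOne] at h2

theorem pointInv_pointMul (g : A →ₐ[k] R) : pointMul (pointInv g) g = pointOne R := by
  have h : pointMul (pointInv (AlgHom.id k A)) (AlgHom.id k A) = pointOne A := by
    apply WithConv.toConv_injective
    rw [toConv_pointMul]
    exact inv_mul_cancel (WithConv.toConv (AlgHom.id k A))
  have h2 := congrArg g.comp h
  rwa [comp_pointMul, comp_pointOne] at h2

theorem eq_pointInv_of_pointMul_eq_pointOne {g h : A →ₐ[k] R} (hgh : pointMul g h = pointOne R) :
    h = pointInv g := by
  rw [← pointOne_pointMul h, ← pointInv_pointMul g, pointMul_assoc, hgh, pointMul_pointOne]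

theorem pointInv_pointMul_rev (g h : A →ₐ[k] R) :
    pointInv (pointMul g h) = pointMul (pointInv h) (pointInv g) := by
  refine (eq_pointInv_of_pointMul_eq_pointOne ?_).symm
  rw [pointMul_assoc, ← pointMul_assoc h, pointMul_pointInv, pointOne_pointMul, pointMul_pointInv]

@[simp]
theorem pointInv_pointInv (g : A →ₐ[k] R) : pointInv (pointInv g) = g :=
  (eq_pointInv_of_pointMul_eq_pointOne (pointInv_pointMul g)).symm

/-- Every homomorphism from `A ⊗ A` restricts along the comultiplication to the product of its two
components. -/
theorem comp_comulAlgHom (f : A ⊗[k] A →ₐ[k] R) :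
    f.comp (Bialgebra.comulAlgHom k A) =
      pointMul (f.comp Algebra.TensorProduct.includeLeft)
        (f.comp Algebra.TensorProduct.includeRight) := by
  rw [pointMul]
  congr 1
  ext <;> simp

theorem antipode_antipode (a : A) :
    HopfAlgebra.antipode k (HopfAlgebra.antipode k a) = a :=
  DFunLike.congr_fun (pointInv_pointInv (AlgHom.id k A)) a

end PointMul

/-! ### Functions vanishing to infinite order at the identity -/

section Separated

variable {k : Type u} [Field k] {A : Type u} [CommRing A] [HopfAlgebra k A]

variable (k A) in
/-- The augmentation ideal, i.e. the ideal of functions that vanish at the identity. -/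
abbrev augIdeal : Ideal A := RingHom.ker (Bialgebra.counitAlgHom k A)

theorem comul_mem_of_mem_augIdeal {a : A} (ha : a ∈ augIdeal k A) :
    Bialgebra.comulAlgHom k A a ∈
      (augIdeal k A).map (Algebra.TensorProduct.includeLeft : A →ₐ[k] A ⊗[k] A) ⊔
      (augIdeal k A).map (Algebra.TensorProduct.includeRight : A →ₐ[k] A ⊗[k] A) := by
  set ε := Bialgebra.counitAlgHom k A
  set K := (augIdeal k A).map (Algebra.TensorProduct.includeLeft : A →ₐ[k] A ⊗[k] A) ⊔
      (augIdeal k A).map (Algebra.TensorProduct.includeRight : A →ₐ[k] A ⊗[k] A) with hK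
  have hsub : ∀ b : A, b - algebraMap k A (ε b) ∈ augIdeal k A := fun b => by
    simp [RingHom.mem_ker, ε]
  have key : ∀ z : A ⊗[k] A, z - algebraMap k _
      (Algebra.TensorProduct.lift ε ε (fun _ _ => Commute.all _ _) z) ∈ K := by
    intro z
    induction z with
    | zero => simp
    | add z z' h h' =>
      rw [map_add, map_add, add_sub_add_comm]
      exact add_mem h h'
    | tmul b c =>
      have : b ⊗ₜ[k] c - algebraMap k _
          (Algebra.TensorProduct.lift ε ε (fun _ _ => Commute.all _ _) (b ⊗ₜ[k] c)) =
          (1 ⊗ₜ[k] c) * ((b - algebraMap k A (ε b)) ⊗ₜ[k] 1) +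
            algebraMap k _ (ε b) * (1 ⊗ₜ[k] (c - algebraMap k A (ε c))) := by
        rw [Algebra.TensorProduct.lift_tmul, ← Algebra.smul_def, Algebra.TensorProduct.tmul_mul_tmul,
          one_mul, mul_one, TensorProduct.sub_tmul, TensorProduct.tmul_sub, smul_sub,
          Algebra.algebraMap_eq_smul_one, Algebra.algebraMap_eq_smul_one,
          Algebra.algebraMap_eq_smul_one, TensorProduct.smul_tmul', TensorProduct.tmul_smul,
          mul_smul, Algebra.TensorProduct.one_def]
        abel
      rw [this]
      refine add_mem (Ideal.mul_mem_left _ _ (Ideal.mem_sup_left ?_))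
        (Ideal.mul_mem_left _ _ (Ideal.mem_sup_right ?_))
      · exact Ideal.mem_map_of_mem (Algebra.TensorProduct.includeLeft : A →ₐ[k] A ⊗[k] A) (hsub b)
      · exact Ideal.mem_map_of_mem (Algebra.TensorProduct.includeRight : A →ₐ[k] A ⊗[k] A) (hsub c)
  have h1 : Algebra.TensorProduct.lift ε ε (fun _ _ => Commute.all _ _)
      (Bialgebra.comulAlgHom k A a) = ε a := by
    have h2 : pointMul (pointOne k : A →ₐ[k] k) (pointOne k) = pointOne k := pointMul_pointOne _
    exact DFunLike.congr_fun h2 a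
  have h := key (Bialgebra.comulAlgHom k A a)
  rw [h1, show ε a = 0 from ha, map_zero, sub_zero] at h
  exact h

theorem tensorContractLeft_eq_zero_of_mem_map {R S : Type u} [CommRing R] [Algebra k R] [CommRing S]
    [Algebra k S] {I : Ideal R} {μ : R →ₗ[k] k} (hμ : ∀ a ∈ I, μ a = 0) {y : R ⊗[k] S}
    (hy : y ∈ I.map (Algebra.TensorProduct.includeLeft : R →ₐ[k] R ⊗[k] S)) :
    tensorContractLeft μ y = 0 := by
  suffices h : ∀ w, tensorContractLeft μ (w * y) = 0 by simpa using h 1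
  refine Submodule.span_induction (p := fun y _ => ∀ w, tensorContractLeft μ (w * y) = 0) ?_
    (by simp) (fun y y' _ _ h h' w => by rw [mul_add, map_add, h, h', add_zero])
    (fun c y _ h w => by rw [smul_eq_mul, ← mul_assoc, h]) hy
  rintro _ ⟨a, ha, rfl⟩ w
  induction w with
  | zero => simp
  | tmul b c => simp [hμ _ (I.mul_mem_left b ha)]
  | add w w' h h' => rw [add_mul, map_add, h, h', add_zero]

theorem tensorContractRight_eq_zero_of_mem_map {R S : Type u} [CommRing R] [Algebra k R]
    [CommRing S] [Algebra k S] {I : Ideal S} {μ : S →ₗ[k] k} (hμ : ∀ a ∈ I, μ a = 0) {y : R ⊗[k] S}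
    (hy : y ∈ I.map (Algebra.TensorProduct.includeRight : S →ₐ[k] R ⊗[k] S)) :
    tensorContractRight μ y = 0 := by
  suffices h : ∀ w, tensorContractRight μ (w * y) = 0 by simpa using h 1
  refine Submodule.span_induction (p := fun y _ => ∀ w, tensorContractRight μ (w * y) = 0) ?_
    (by simp) (fun y y' _ _ h h' w => by rw [mul_add, map_add, h, h', add_zero])
    (fun c y _ h w => by rw [smul_eq_mul, ← mul_assoc, h]) hy
  rintro _ ⟨a, ha, rfl⟩ w
  induction w with
  | zero => simp
  | tmul b c => simp [hμ _ (I.mul_mem_left c ha)]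
  | add w w' h h' => rw [add_mul, map_add, h, h', add_zero]

/-- Functionals vanishing on powers of the augmentation ideal are closed under convolution. -/
theorem apply_tensorContractRight_comul_eq_zero {μ ν : A →ₗ[k] k} {i j : ℕ}
    (hμ : ∀ a ∈ augIdeal k A ^ i, μ a = 0) (hν : ∀ a ∈ augIdeal k A ^ j, ν a = 0) {f : A}
    (hf : f ∈ augIdeal k A ^ (i + j)) :
    μ (tensorContractRight ν (Bialgebra.comulAlgHom k A f)) = 0 := by
  set K₁ := (augIdeal k A).map (Algebra.TensorProduct.includeLeft : A →ₐ[k] A ⊗[k] A) with hK₁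
  set K₂ := (augIdeal k A).map (Algebra.TensorProduct.includeRight : A →ₐ[k] A ⊗[k] A) with hK₂
  have h1 : Bialgebra.comulAlgHom k A f ∈ K₁ ^ i ⊔ K₂ ^ j := by
    refine Ideal.sup_pow_add_le_pow_sup_pow ?_
    have h2 : (augIdeal k A).map (Bialgebra.comulAlgHom k A) ≤ K₁ ⊔ K₂ :=
      Ideal.map_le_iff_le_comap.2 fun a ha => comul_mem_of_mem_augIdeal ha
    refine Ideal.pow_right_mono h2 _ ?_
    rw [← Ideal.map_pow]
    exact Ideal.mem_map_of_mem _ hf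
  obtain ⟨y, hy, z, hz, hyz⟩ := Submodule.mem_sup.1 h1
  rw [← hyz, map_add, map_add]
  rw [hK₁, ← Ideal.map_pow] at hy
  rw [hK₂, ← Ideal.map_pow] at hz
  rw [tensorContractRight_eq_zero_of_mem_map hν hz, map_zero, add_zero, apply_tensorContractRight,
    tensorContractLeft_eq_zero_of_mem_map hμ hy, map_zero]

/-- On a connected affine group scheme of finite type the ideal `J` of functions vanishing to
infinite order at the identity is zero. By Krull's theorem `J` is killed by some `r` with
`r(e) = 1`. Translating, `r(x y⁻¹) f(x) = 0` for `f ∈ J` and `y` in the closed subscheme defined by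
`J`; the coefficients of `r(x y⁻¹)` thus annihilate `J`, while on the diagonal they combine to `1`
modulo `J`. So `J` is generated by an idempotent, which
connectedness forces to be zero. -/
theorem eq_zero_of_forall_mem_augIdeal_pow [IsNoetherianRing A] [ConnectedSpace (PrimeSpectrum A)]
    {f : A} (hf : ∀ j, f ∈ augIdeal k A ^ j) : f = 0 := by
  set m := augIdeal k A with hm
  set J : Ideal A := ⨅ j, m ^ j with hJ
  have hmemJ : ∀ {a : A}, a ∈ J ↔ ∀ j, a ∈ m ^ j := by simp [hJ]
  obtain ⟨r, hr1, hr⟩ : ∃ r : A, r - 1 ∈ m ∧ ∀ a ∈ J, r * a = 0 := by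
    refine Submodule.exists_sub_one_mem_and_smul_eq_zero_of_fg_of_le_smul m J
      (IsNoetherian.noetherian J) fun a ha => ?_
    have h1 : a ∈ (⨅ i : ℕ, m ^ i • ⊤ : Submodule A A) := by
      simpa [hJ] using hmemJ.1 ha
    obtain ⟨s, hs⟩ := (Ideal.mem_iInf_smul_pow_eq_bot_iff m a).1 h1
    rw [← hs]
    exact Submodule.smul_mem_smul s.2 ha
  have hεr : Bialgebra.counitAlgHom k A r = 1 := by
    have : Bialgebra.counitAlgHom k A (r - 1) = 0 := hr1
    rwa [map_sub, map_one, sub_eq_zero] at this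
  have hJ_of : ∀ a : A, (∀ (j : ℕ) (μ : A →ₗ[k] k), (∀ b ∈ m ^ j, μ b = 0) → μ a = 0) → a ∈ J := by
    intro a ha
    rw [hmemJ]
    intro j
    by_contra hne
    obtain ⟨μ, hμa, hμ⟩ := Submodule.exists_le_ker_of_notMem
      (p := (m ^ j).restrictScalars k) (v := a) hne
    exact hμa (ha j μ fun b hb => hμ hb)
  let mk : A →ₐ[k] A ⧸ J := Ideal.Quotient.mkₐ k J
  -- the coefficients of `f(x y)` with `y` restricted to the subscheme defined by `J` lie in `J`
  have hcoef : ∀ f ∈ J, ∀ μ : A ⧸ J →ₗ[k] k, tensorContractRight μ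
      (Algebra.TensorProduct.map (AlgHom.id k A) mk (Bialgebra.comulAlgHom k A f)) ∈ J := by
    intro f hf μ
    refine hJ_of _ fun i lam hlam => ?_
    rw [apply_tensorContractRight]
    suffices h : tensorContractLeft lam
        (Algebra.TensorProduct.map (AlgHom.id k A) mk (Bialgebra.comulAlgHom k A f)) = 0 by
      rw [h, map_zero]
    have h1 : ∀ z : A ⊗[k] A, tensorContractLeft lam
        (Algebra.TensorProduct.map (AlgHom.id k A) mk z) = mk (tensorContractLeft lam z) := by
      intro z
      induction z with
      | zero => simp
      | tmul a b => simp
      | add z z' h h' => simp only [map_add, h, h']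
    rw [h1]
    refine Ideal.Quotient.eq_zero_iff_mem.2 (hJ_of _ fun j nu hnu => ?_)
    rw [← apply_tensorContractRight]
    exact apply_tensorContractRight_comul_eq_zero hlam hnu (hmemJ.1 hf (i + j))
  have hkill : ∀ f ∈ J, (r ⊗ₜ[k] (1 : A ⧸ J)) *
      Algebra.TensorProduct.map (AlgHom.id k A) mk (Bialgebra.comulAlgHom k A f) = 0 := by
    intro f hf
    refine eq_zero_of_tensorContractRight_eq_zero fun μ => ?_
    have h1 : ∀ z : A ⊗[k] (A ⧸ J), tensorContractRight μ ((r ⊗ₜ[k] 1) * z) =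
        r * tensorContractRight μ z := by
      intro z
      induction z with
      | zero => simp
      | tmul a b => simp
      | add z z' h h' => simp only [mul_add, map_add, h, h']
    rw [h1]
    exact hr _ (hcoef f hf μ)
  let i₁ : A →ₐ[k] A ⊗[k] (A ⧸ J) := Algebra.TensorProduct.includeLeft
  let i₂ : A →ₐ[k] A ⊗[k] (A ⧸ J) := Algebra.TensorProduct.includeRight.comp mk
  -- `z` is the function `r(x y⁻¹)`
  set z := pointMul i₁ (pointInv i₂) r with hz
  have hzJ : ∀ f ∈ J, z * (f ⊗ₜ[k] 1) = 0 := by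
    intro f hf
    let Ψ : A ⊗[k] (A ⧸ J) →ₐ[k] A ⊗[k] (A ⧸ J) := Algebra.TensorProduct.lift
      (pointMul i₁ (pointInv i₂)) Algebra.TensorProduct.includeRight (fun _ _ => Commute.all _ _)
    have h1 := congrArg Ψ (hkill f hf)
    rw [map_mul, map_zero] at h1
    have hΨ : ∀ a, Ψ (a ⊗ₜ[k] 1) = pointMul i₁ (pointInv i₂) a := fun a => by
      rw [Algebra.TensorProduct.lift_tmul, map_one, mul_one]
    have h2 : Ψ (r ⊗ₜ[k] 1) = z := hΨ r
    have h3 : Ψ (Algebra.TensorProduct.map (AlgHom.id k A) mk (Bialgebra.comulAlgHom k A f)) =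
        f ⊗ₜ[k] 1 := by
      have h4 := comp_comulAlgHom (Ψ.comp (Algebra.TensorProduct.map (AlgHom.id k A) mk))
      have h5 : (Ψ.comp (Algebra.TensorProduct.map (AlgHom.id k A) mk)).comp
          Algebra.TensorProduct.includeLeft = pointMul i₁ (pointInv i₂) := by
        ext a
        change Ψ (Algebra.TensorProduct.map (AlgHom.id k A) mk (a ⊗ₜ[k] 1)) = _
        rw [Algebra.TensorProduct.map_tmul, map_one]
        exact hΨ a
      have h6 : (Ψ.comp (Algebra.TensorProduct.map (AlgHom.id k A) mk)).comp
          Algebra.TensorProduct.includeRight = i₂ := by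
        ext a
        simp [Ψ, i₂]
      rw [h5, h6, pointMul_assoc, pointInv_pointMul, pointMul_pointOne] at h4
      exact DFunLike.congr_fun h4 f
    rwa [h2, h3] at h1
  obtain ⟨s, hs⟩ := eq_sum_tensorContractRight_tmul (Module.Basis.ofVectorSpace k (A ⧸ J)) z
  set b := Module.Basis.ofVectorSpace k (A ⧸ J)
  have hcoefz : ∀ f ∈ J, ∀ μ : A ⧸ J →ₗ[k] k, tensorContractRight μ z * f = 0 := by
    intro f hf μ
    have h1 : ∀ z : A ⊗[k] (A ⧸ J), tensorContractRight μ (z * (f ⊗ₜ[k] 1)) =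
        tensorContractRight μ z * f := by
      intro z
      induction z with
      | zero => simp
      | tmul a b => simp
      | add z z' h h' => simp only [add_mul, map_add, h, h']
    rw [← h1, hzJ f hf, map_zero]
  choose c hc using fun i => Ideal.Quotient.mk_surjective (b i)
  set u := ∑ i ∈ s, tensorContractRight (b.coord i) z * c i with hu
  have huJ : ∀ f ∈ J, u * f = 0 := by
    intro f hf
    rw [hu, Finset.sum_mul]
    refine Finset.sum_eq_zero fun i _ => ?_
    rw [mul_right_comm, hcoefz f hf, zero_mul]
  have hu1 : mk u = 1 := by
    let M : A ⊗[k] (A ⧸ J) →ₐ[k] A ⧸ J :=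
      Algebra.TensorProduct.lift mk (AlgHom.id k _) (fun _ _ => Commute.all _ _)
    have h1 : M z = 1 := by
      have h2 : M.comp (pointMul i₁ (pointInv i₂)) = pointOne (A ⧸ J) := by
        rw [comp_pointMul]
        have h3 : M.comp i₁ = mk := by ext a; simp [M, i₁]
        have h4 : M.comp (pointInv i₂) = pointInv mk := by ext a; simp [M, i₂, pointInv]
        rw [h3, h4, pointMul_pointInv]
      have h5 := DFunLike.congr_fun h2 r
      have h6 : (pointOne (A ⧸ J) : A →ₐ[k] A ⧸ J) r = 1 := by
        change algebraMap k _ (Bialgebra.counitAlgHom k A r) = 1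
        rw [hεr, map_one]
      exact h5.trans h6
    rw [hs, map_sum] at h1
    rw [hu, map_sum, ← h1]
    refine Finset.sum_congr rfl fun i _ => ?_
    simp only [M, Algebra.TensorProduct.lift_tmul, AlgHom.id_apply, map_mul, ← hc i]
    rfl
  have h1u : 1 - u ∈ J := by
    rw [← Ideal.Quotient.eq_zero_iff_mem, map_sub, map_one, sub_eq_zero]
    exact hu1.symm
  have hidem : IsIdempotentElem (1 - u) := by
    have := huJ _ h1u
    change (1 - u) * (1 - u) = 1 - u
    rw [sub_mul, one_mul, this, sub_zero]
  have hclopen : IsClopen (PrimeSpectrum.basicOpen (1 - u) : Set (PrimeSpectrum A)) :=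
    PrimeSpectrum.isClopen_iff.2 ⟨1 - u, hidem, rfl⟩
  have hu0 : 1 - u = 0 := by
    rcases isClopen_iff.1 hclopen with h | h
    · have h2 : IsNilpotent (1 - u) := by
        rw [← PrimeSpectrum.basicOpen_eq_bot_iff]
        exact TopologicalSpace.Opens.ext h
      exact hidem.eq_zero_of_isNilpotent h2
    · let P : PrimeSpectrum A := ⟨m, RingHom.ker_isPrime _⟩
      have h2 : P ∈ (PrimeSpectrum.basicOpen (1 - u) : Set (PrimeSpectrum A)) := by
        rw [h]
        trivial
      exact absurd (by simpa using hmemJ.1 h1u 1) h2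
  have h := huJ f (hmemJ.2 hf)
  rwa [← sub_eq_zero.1 hu0, one_mul] at h

end Separated

/-! ### An upper bound for the growth of an algebra -/

section UpperBound

variable {σ k A : Type*} [Field k] [CommRing A] [Algebra k A]

theorem linearIndependent_monomialIn {m : MonomialOrder σ} {x : σ → A}
    {ψ : A →ₐ[k] MvPowerSeries σ k} (hψ : ∀ i, IsInitExp m (ψ (x i)) (Finsupp.single i 1)) :
    LinearIndependent k (monomialIn x) := by
  refine LinearIndependent.of_comp ψ.toLinearMap
    (linearIndependent_of_isInitExp (m := m) (u := id) Function.injective_id fun u => ?_)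
  change IsInitExp m (ψ (monomialIn x u)) u
  rw [map_monomialIn]
  exact isInitExp_monomial hψ u

theorem algebraicIndependent_of_isInitExp {m : MonomialOrder σ} {x : σ → A}
    {ψ : A →ₐ[k] MvPowerSeries σ k} (hψ : ∀ i, IsInitExp m (ψ (x i)) (Finsupp.single i 1)) :
    AlgebraicIndependent k x := by
  rw [algebraicIndependent_iff]
  intro p hp
  by_contra hne
  obtain ⟨u, hu⟩ := MvPolynomial.support_nonempty.2 hne
  have hmon : ∀ u : σ →₀ ℕ, IsInitExp m (ψ (monomialIn x u)) (id u) := fun u => by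
    rw [map_monomialIn]
    exact isInitExp_monomial hψ u
  obtain ⟨v, _, hv⟩ := coeff_sum_ne_zero Function.injective_id hmon (s := p.support)
    (c := fun u => p.coeff u) ⟨u, hu, MvPolynomial.mem_support_iff.1 hu⟩
  apply hv
  have h : MvPolynomial.aeval x p = ∑ u ∈ p.support, p.coeff u • monomialIn x u := by
    conv_lhs => rw [p.as_sum, map_sum]
    refine Finset.sum_congr rfl fun u _ => ?_
    rw [MvPolynomial.aeval_monomial, Algebra.smul_def]
    rfl
  simp_rw [← map_smul]
  rw [← map_sum, ← h, hp, map_zero, map_zero]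

theorem finrank_restrictTotalDegree_le [Fintype σ] (d : ℕ) :
    Module.finrank k (MvPolynomial.restrictTotalDegree σ k d) ≤ (d + 1) ^ Fintype.card σ := by
  classical
  set s : Set (σ →₀ ℕ) := {n | (n.sum fun _ e => e) ≤ d} with hs
  have hsub : s ⊆ ((exponentBox Finset.univ (d + 1) : Finset (σ →₀ ℕ)) : Set (σ →₀ ℕ)) := by
    intro n hn
    rw [Finset.mem_coe, mem_exponentBox]
    intro i
    simp only [Finset.mem_univ, if_true]
    exact Nat.lt_succ_of_le ((Finsupp.le_degree i n).trans hn)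
  have hfin : Finite s := (Finset.finite_toSet _).subset hsub
  have h1 := Module.finrank_eq_nat_card_basis (MvPolynomial.basisRestrictSupport k s)
  have h2 := Set.ncard_le_ncard hsub (Finset.finite_toSet _)
  rw [Set.ncard_coe_finset, card_exponentBox, Finset.card_univ] at h2
  exact h1.le.trans h2

/-- The differentials of coordinates at `ε` generate the Kähler differentials near `ε`, by
Nakayama's lemma. -/
theorem IsCoordinateSystem.exists_smul_kaehler_eq_zero [Algebra.FiniteType k A] {ε : A →ₐ[k] k}
    {x : σ → A} (hx : IsCoordinateSystem ε x) [Algebra (MvPolynomial σ k) A]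
    [IsScalarTower k (MvPolynomial σ k) A]
    (hX : ∀ i, algebraMap (MvPolynomial σ k) A (MvPolynomial.X i) = x i) :
    ∃ r : A, ε r = 1 ∧ ∀ ω : Ω[A⁄MvPolynomial σ k], r • ω = 0 := by
  have hft : Algebra.FiniteType (MvPolynomial σ k) A :=
    Algebra.FiniteType.of_restrictScalars_finiteType k _ A
  set m := RingHom.ker ε with hm
  set D := KaehlerDifferential.D (MvPolynomial σ k) A with hD
  have hxm : Ideal.span (Set.range x) ≤ m :=
    Ideal.span_le.2 (by rintro _ ⟨i, rfl⟩; exact hx.apply_eq_zero i)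
  have hspan : ∀ y ∈ Ideal.span (Set.range x),
      D y ∈ (m • ⊤ : Submodule A (Ω[A⁄MvPolynomial σ k])) := by
    intro y hy
    induction hy using Submodule.span_induction with
    | mem y hy =>
      obtain ⟨i, rfl⟩ := hy
      rw [← hX, D.map_algebraMap]
      exact zero_mem _
    | zero => rw [map_zero]; exact zero_mem _
    | add y y' _ _ h h' => rw [map_add]; exact add_mem h h'
    | smul c y hy h =>
      rw [smul_eq_mul, D.leibniz]
      exact add_mem (Submodule.smul_mem _ _ h)
        (Submodule.smul_mem_smul (hxm hy) Submodule.mem_top)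
  have hsq : ∀ z ∈ m ^ 2, D z ∈ (m • ⊤ : Submodule A (Ω[A⁄MvPolynomial σ k])) := by
    intro z hz
    rw [pow_two] at hz
    refine Submodule.mul_induction_on hz (fun a ha b hb => ?_) fun a b ha hb => ?_
    · rw [D.leibniz]
      exact add_mem (Submodule.smul_mem_smul ha Submodule.mem_top)
        (Submodule.smul_mem_smul hb Submodule.mem_top)
    · rw [map_add]
      exact add_mem ha hb
  have htop : (⊤ : Submodule A (Ω[A⁄MvPolynomial σ k])) ≤ m • ⊤ := by
    rw [← KaehlerDifferential.span_range_derivation, Submodule.span_le]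
    rintro _ ⟨a, rfl⟩
    have ha : a = algebraMap (MvPolynomial σ k) A (MvPolynomial.C (ε a)) +
        (a - algebraMap k A (ε a)) := by
      rw [← MvPolynomial.algebraMap_eq, ← IsScalarTower.algebraMap_apply]
      ring
    have hak : a - algebraMap k A (ε a) ∈ m := by simp [hm, RingHom.mem_ker]
    obtain ⟨y, hy, z, hz, hyz⟩ := Submodule.mem_sup.1 (hx.ker_le hak)
    rw [KaehlerDifferential.span_range_derivation, SetLike.mem_coe, ha, ← hyz, map_add, map_add,
      D.map_algebraMap, zero_add]
    exact add_mem (hspan y hy) (hsq z hz)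
  obtain ⟨r, hr, h⟩ := Submodule.exists_sub_one_mem_and_smul_eq_zero_of_fg_of_le_smul m ⊤
    Module.Finite.fg_top htop
  refine ⟨r, ?_, fun ω => h ω Submodule.mem_top⟩
  have : ε (r - 1) = 0 := hr
  rwa [map_sub, map_one, sub_eq_zero] at this

/-- The function field is finite over the field generated by coordinates at a rational point:
it is formally unramified over it. -/
theorem IsCoordinateSystem.finite_fractionRing [IsDomain A] [Algebra.FiniteType k A]
    {ε : A →ₐ[k] k} {x : σ → A} (hx : IsCoordinateSystem ε x) [Algebra (MvPolynomial σ k) A]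
    [IsScalarTower k (MvPolynomial σ k) A]
    (hX : ∀ i, algebraMap (MvPolynomial σ k) A (MvPolynomial.X i) = x i)
    (K L : Type*) [Field K] [Field L] [Algebra A L] [IsFractionRing A L]
    [Algebra (MvPolynomial σ k) K] [Algebra (MvPolynomial σ k) L] [Algebra K L]
    [IsScalarTower (MvPolynomial σ k) A L] [IsScalarTower (MvPolynomial σ k) K L] :
    Module.Finite K L := by
  obtain ⟨r, hr, hrω⟩ := hx.exists_smul_kaehler_eq_zero hX
  have hft : Algebra.FiniteType (MvPolynomial σ k) A :=
    Algebra.FiniteType.of_restrictScalars_finiteType k _ A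
  have het : Algebra.FormallyEtale A L := Algebra.FormallyEtale.of_isLocalization (nonZeroDivisors A)
  have hr0 : algebraMap A L r ≠ 0 := by
    rw [Ne, FaithfulSMul.algebraMap_eq_zero_iff]
    rintro rfl
    simp at hr
  have hunr : Algebra.FormallyUnramified (MvPolynomial σ k) L := by
    rw [Algebra.formallyUnramified_iff]
    refine (KaehlerDifferential.tensorKaehlerEquivOfFormallyEtale
      (MvPolynomial σ k) A L).symm.toEquiv.subsingleton_congr.2 ?_
    refine subsingleton_of_forall_eq 0 fun z => ?_
    induction z with
    | zero => rfl
    | add z z' h h' => rw [h, h', add_zero]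
    | tmul l ω =>
      have : l = r • ((algebraMap A L r)⁻¹ * l) := by
        rw [Algebra.smul_def, ← mul_assoc, mul_inv_cancel₀ hr0, one_mul]
      rw [this, TensorProduct.smul_tmul, hrω, TensorProduct.tmul_zero]
  have h1 : Algebra.FormallyUnramified K L :=
    Algebra.FormallyUnramified.of_restrictScalars (MvPolynomial σ k) K L
  have h2 : Algebra.EssFiniteType A L := Algebra.EssFiniteType.of_isLocalization L (nonZeroDivisors A)
  have h3 : Algebra.EssFiniteType (MvPolynomial σ k) L := Algebra.EssFiniteType.comp _ A L
  have h4 : Algebra.EssFiniteType K L := Algebra.EssFiniteType.of_comp (MvPolynomial σ k) K L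
  exact Algebra.FormallyUnramified.finite_of_free K L

/-- The powers of a finite-dimensional subspace of a domain grow at most with the degree given by
the number of coordinates at a rational point. In a basis of the function field over the field of
rational functions in the coordinates, the `d`-th power has a common denominator `g ^ (d + 1)` and
numerators of degree linear in `d`. -/
theorem IsCoordinateSystem.exists_finrank_pow_le [Fintype σ] [IsDomain A] [Algebra.FiniteType k A]
    {ε : A →ₐ[k] k} {x : σ → A} (hx : IsCoordinateSystem ε x) (hind : AlgebraicIndependent k x)
    {V : Submodule k A} (hV : V.FG) :
    ∃ C : ℕ, ∀ d, 1 ≤ d → Module.finrank k (V ^ d : Submodule k A) ≤ C * d ^ Fintype.card σ := by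
  classical
  let P := MvPolynomial σ k
  let algPA : Algebra P A := (MvPolynomial.aeval x).toAlgebra
  have hPA : ∀ p : P, algebraMap P A p = MvPolynomial.aeval x p := fun p => rfl
  have tower1 : IsScalarTower k P A := IsScalarTower.of_algebraMap_eq fun c => by
    rw [hPA, MvPolynomial.algebraMap_eq, MvPolynomial.aeval_C]
  let L := FractionRing A
  have hinjPA : Function.Injective (algebraMap P A) := hind
  have hinjAL : Function.Injective (algebraMap A L) := IsFractionRing.injective A L
  have hinjPL : Function.Injective (algebraMap P L) := by
    rw [IsScalarTower.algebraMap_eq P A L]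
    exact hinjAL.comp hinjPA
  have : FaithfulSMul P L := (faithfulSMul_iff_algebraMap_injective P L).2 hinjPL
  let K := FractionRing P
  let algKL : Algebra K L := FractionRing.liftAlgebra P L
  have tower2 : IsScalarTower P K L := FractionRing.isScalarTower_liftAlgebra P L
  have hfinKL : Module.Finite K L := hx.finite_fractionRing (fun i => by
    rw [hPA, MvPolynomial.aeval_X]) K L
  let b := Module.finBasis K L
  obtain ⟨T, hT⟩ := hV
  -- a common denominator `g` for the structure constants of the multiplication by generators
  let E : Finset K := (T.image fun t => Finset.univ.image fun ij : Fin _ × Fin _ =>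
      b.repr (algebraMap A L t * b ij.1) ij.2).sup id ∪ Finset.univ.image fun j => b.repr 1 j
  obtain ⟨g, hg⟩ := IsLocalization.exist_integer_multiples_of_finset (nonZeroDivisors P) E
  have hg0 : (g : P) ≠ 0 := nonZeroDivisors.coe_ne_zero g
  have hc : ∀ t : T, ∀ i j, ∃ c : P,
      algebraMap P K c = (g : P) • b.repr (algebraMap A L t * b i) j := by
    intro t i j
    refine hg _ (Finset.mem_union_left _ ?_)
    rw [Finset.mem_sup]
    exact ⟨_, Finset.mem_image_of_mem _ t.2, Finset.mem_image.2 ⟨(i, j), by simp, rfl⟩⟩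
  have he : ∀ j, ∃ e : P, algebraMap P K e = (g : P) • b.repr 1 j := fun j =>
    hg _ (Finset.mem_union_right _ (Finset.mem_image_of_mem _ (Finset.mem_univ j)))
  choose c hc using hc
  choose e he using he
  obtain ⟨D, hDc, hDe⟩ : ∃ D : ℕ, (∀ t i j, (c t i j).totalDegree ≤ D) ∧
      ∀ j, (e j).totalDegree ≤ D := by
    refine ⟨(Finset.univ.sup fun tij : T × Fin _ × Fin _ =>
      (c tij.1 tij.2.1 tij.2.2).totalDegree) ⊔ Finset.univ.sup fun j => (e j).totalDegree,
      fun t i j => le_sup_of_le_left ?_, fun j => le_sup_of_le_right ?_⟩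
    · exact Finset.le_sup (f := fun tij : T × Fin _ × Fin _ =>
        (c tij.1 tij.2.1 tij.2.2).totalDegree) (Finset.mem_univ (t, i, j))
    · exact Finset.le_sup (f := fun j => (e j).totalDegree) (Finset.mem_univ j)
  set γ : L := algebraMap P L g with hγ
  have hγ0 : γ ≠ 0 := by
    rw [hγ, Ne, map_eq_zero_iff _ hinjPL]
    exact hg0
  have hexp : ∀ (y : L) (q : Fin (Module.finrank K L) → P),
      (∀ j, algebraMap P K (q j) = (g : P) • b.repr y j) →
      γ * y = ∑ j, algebraMap P L (q j) * b j := by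
    intro y q hq
    conv_lhs => rw [← b.sum_repr y, Finset.mul_sum]
    refine Finset.sum_congr rfl fun j _ => ?_
    rw [IsScalarTower.algebraMap_apply P K L (q j), hq, Algebra.smul_def, Algebra.smul_def, map_mul,
      ← IsScalarTower.algebraMap_apply, mul_assoc]
  -- `Y d` consists of the elements with denominator `g ^ d` and numerators of degree at most `D d`
  let Θ : ∀ d : ℕ, (Fin (Module.finrank K L) → MvPolynomial.restrictTotalDegree σ k (D * d)) →ₗ[k]
      L := fun d => ∑ j, LinearMap.mulRight k ((γ ^ d)⁻¹ * b j) ∘ₗ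
        (IsScalarTower.toAlgHom k P L).toLinearMap ∘ₗ Submodule.subtype _ ∘ₗ LinearMap.proj j
  have hΘ : ∀ d p, γ ^ d * Θ d p = ∑ j, algebraMap P L (p j) * b j := by
    intro d p
    have h : Θ d p = ∑ j, algebraMap P L (p j) * ((γ ^ d)⁻¹ * b j) := by
      simp only [Θ, LinearMap.sum_apply]
      rfl
    rw [h, Finset.mul_sum]
    refine Finset.sum_congr rfl fun j _ => ?_
    rw [mul_left_comm, mul_inv_cancel_left₀ (pow_ne_zero d hγ0)]
  have hmemY : ∀ (d : ℕ) (y : L), y ∈ LinearMap.range (Θ d) ↔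
      ∃ q : Fin (Module.finrank K L) → P, (∀ j, (q j).totalDegree ≤ D * d) ∧
        γ ^ d * y = ∑ j, algebraMap P L (q j) * b j := by
    intro d y
    constructor
    · rintro ⟨p, rfl⟩
      exact ⟨fun j => p j, fun j => (MvPolynomial.mem_restrictTotalDegree _ _ _).1 (p j).2, hΘ d p⟩
    · rintro ⟨q, hq, hy⟩
      refine ⟨fun j => ⟨q j, (MvPolynomial.mem_restrictTotalDegree _ _ _).2 (hq j)⟩, ?_⟩
      exact mul_left_cancel₀ (pow_ne_zero d hγ0) ((hΘ d _).trans hy.symm)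
  have hVY : ∀ d, ∀ v ∈ V ^ d, algebraMap A L v ∈ LinearMap.range (Θ (d + 1)) := by
    intro d
    induction d with
    | zero =>
      intro v hv
      rw [pow_zero, Submodule.mem_one] at hv
      obtain ⟨a, rfl⟩ := hv
      rw [← IsScalarTower.algebraMap_apply, Algebra.algebraMap_eq_smul_one]
      refine Submodule.smul_mem _ _ ((hmemY _ _).2 ⟨e, by simpa using hDe, ?_⟩)
      rw [zero_add, pow_one]
      exact hexp 1 e he
    | succ d ih =>
      intro v hv
      rw [pow_succ'] at hv
      refine Submodule.mul_induction_on hv (fun a ha y hy => ?_) fun a b ha hb => by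
        rw [map_add]; exact add_mem ha hb
      rw [← hT] at ha
      induction ha using Submodule.span_induction with
      | mem t ht =>
        obtain ⟨q, hq, hqy⟩ := (hmemY _ _).1 (ih y hy)
        refine (hmemY _ _).2 ⟨fun j => ∑ i, q i * c ⟨t, ht⟩ i j, fun j => ?_, ?_⟩
        · refine MvPolynomial.totalDegree_finsetSum_le fun i _ => ?_
          refine (MvPolynomial.totalDegree_mul _ _).trans ?_
          rw [mul_add D (d + 1) 1, mul_one]
          exact add_le_add (hq i) (hDc _ i j)
        · calc γ ^ (d + 1 + 1) * algebraMap A L (t * y)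
              = γ * algebraMap A L t * (γ ^ (d + 1) * algebraMap A L y) := by
                rw [map_mul]; ring
            _ = ∑ i, algebraMap P L (q i) * (γ * (algebraMap A L t * b i)) := by
                rw [hqy, Finset.mul_sum]
                exact Finset.sum_congr rfl fun i _ => by ring
            _ = ∑ i, ∑ j, algebraMap P L (q i) * (algebraMap P L (c ⟨t, ht⟩ i j) * b j) := by
                refine Finset.sum_congr rfl fun i _ => ?_
                rw [hexp _ _ (hc ⟨t, ht⟩ i), Finset.mul_sum]
            _ = ∑ j, algebraMap P L (∑ i, q i * c ⟨t, ht⟩ i j) * b j := by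
                rw [Finset.sum_comm]
                refine Finset.sum_congr rfl fun j _ => ?_
                rw [map_sum, Finset.sum_mul]
                exact Finset.sum_congr rfl fun i _ => by rw [map_mul, mul_assoc]
      | zero => rw [zero_mul, map_zero]; exact zero_mem _
      | add a a' _ _ h h' => rw [add_mul, map_add]; exact add_mem h h'
      | smul s a _ h =>
        rw [smul_mul_assoc, Algebra.smul_def, map_mul, ← IsScalarTower.algebraMap_apply,
          ← Algebra.smul_def]
        exact Submodule.smul_mem _ _ h
  refine ⟨Module.finrank K L * (2 * D + 1) ^ Fintype.card σ, fun d hd => ?_⟩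
  let j : (V ^ d : Submodule k A) →ₗ[k] LinearMap.range (Θ (d + 1)) :=
    ((IsScalarTower.toAlgHom k A L).toLinearMap ∘ₗ Submodule.subtype _).codRestrict _
      fun v => hVY d v v.2
  have hj : Function.Injective j := fun v w hvw =>
    Subtype.ext (hinjAL (congrArg Subtype.val hvw))
  have h1 := LinearMap.finrank_le_finrank_of_injective hj
  have h2 := LinearMap.finrank_range_le (Θ (d + 1))
  rw [Module.finrank_pi_fintype, Finset.sum_const, Finset.card_univ, Fintype.card_fin,
    smul_eq_mul] at h2
  refine h1.trans (h2.trans ?_)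
  rw [mul_assoc, ← mul_pow]
  refine Nat.mul_le_mul_left _ ((finrank_restrictTotalDegree_le _).trans ?_)
  refine Nat.pow_le_pow_left ?_ _
  nlinarith

end UpperBound

/-! ### The degree filtration -/

/-- An increasing multiplicative filtration by subspaces; it need not exhaust the algebra. -/
structure IsAlgebraFiltration {k E : Type*} [Field k] [CommRing E] [Algebra k E]
    (G : ℕ → Submodule k E) : Prop where
  one_mem : 1 ∈ G 0
  mono : Monotone G
  mul_mem : ∀ a b, ∀ x ∈ G a, ∀ y ∈ G b, x * y ∈ G (a + b)

namespace IsAlgebraFiltration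

variable {k E : Type*} [Field k] [CommRing E] [Algebra k E] {G : ℕ → Submodule k E}

theorem pow_mem (hG : IsAlgebraFiltration G) {a : ℕ} {x : E} (hx : x ∈ G a) (n : ℕ) :
    x ^ n ∈ G (n * a) := by
  induction n with
  | zero => simpa using hG.one_mem
  | succ n ih =>
    rw [pow_succ, Nat.succ_mul]
    exact hG.mul_mem _ _ _ ih _ hx

theorem monomialIn_mem (hG : IsAlgebraFiltration G) {σ : Type*} {a : ℕ} {y : σ → E}
    (hy : ∀ i, y i ∈ G a) (u : σ →₀ ℕ) : monomialIn y u ∈ G (u.degree * a) := by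
  classical
  have key : ∀ s : Finset σ, ∏ i ∈ s, y i ^ u i ∈ G ((∑ i ∈ s, u i) * a) := by
    intro s
    induction s using Finset.induction_on with
    | empty => simpa using hG.one_mem
    | insert i s hi ih =>
      rw [Finset.prod_insert hi, Finset.sum_insert hi, add_mul]
      exact hG.mul_mem _ _ _ (hG.pow_mem (hy i) _) _ ih
  exact key u.support

theorem aeval_mem (hG : IsAlgebraFiltration G) {σ : Type*} {y : σ → E} (hy : ∀ i, y i ∈ G 1)
    (f : MvPolynomial σ k) : MvPolynomial.aeval y f ∈ G f.totalDegree := by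
  rw [f.as_sum, map_sum, ← f.as_sum]
  refine Submodule.sum_mem _ fun u hu => ?_
  rw [MvPolynomial.aeval_monomial, ← Algebra.smul_def]
  refine Submodule.smul_mem _ _ (hG.mono ?_ (hG.monomialIn_mem hy u))
  rw [mul_one]
  exact MvPolynomial.le_totalDegree hu

theorem pow_of_one_mem {V : Submodule k E} (hV : 1 ∈ V) : IsAlgebraFiltration fun d => V ^ d where
  one_mem := by
    rw [pow_zero]
    exact Submodule.mem_one.2 ⟨1, map_one _⟩
  mono := pow_right_monotone (Submodule.one_le.2 hV)
  mul_mem a b x hx y hy := by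
    rw [pow_add]
    exact Submodule.mul_mem_mul hx hy

theorem comp_mul (hG : IsAlgebraFiltration G) (L : ℕ) : IsAlgebraFiltration fun d => G (L * d) where
  one_mem := hG.one_mem
  mono a b h := hG.mono (Nat.mul_le_mul_left L h)
  mul_mem a b x hx y hy := by
    rw [mul_add]
    exact hG.mul_mem _ _ x hx y hy

theorem inf (hG : IsAlgebraFiltration G) (C : Subalgebra k E) :
    IsAlgebraFiltration fun d => C.toSubmodule ⊓ G d where
  one_mem := ⟨C.one_mem, hG.one_mem⟩
  mono _ _ h := inf_le_inf_left _ (hG.mono h)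
  mul_mem _ _ x hx y hy := ⟨C.mul_mem hx.1 hy.1, hG.mul_mem _ _ x hx.2 y hy.2⟩

theorem map (hG : IsAlgebraFiltration G) {E' : Type*} [CommRing E'] [Algebra k E']
    (f : E →ₐ[k] E') : IsAlgebraFiltration fun d => (G d).map f.toLinearMap where
  one_mem := ⟨1, hG.one_mem, map_one f⟩
  mono a b h := Submodule.map_mono (hG.mono h)
  mul_mem := by
    rintro a b _ ⟨x, hx, rfl⟩ _ ⟨y, hy, rfl⟩
    exact ⟨x * y, hG.mul_mem _ _ x hx y hy, map_mul f x y⟩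

/-- The diagonal part of the tensor square of a filtration. -/
theorem tensor (hG : IsAlgebraFiltration G) : IsAlgebraFiltration fun d =>
    LinearMap.range (TensorProduct.map (G d).subtype (G d).subtype) where
  one_mem := ⟨⟨1, hG.one_mem⟩ ⊗ₜ ⟨1, hG.one_mem⟩, rfl⟩
  mono a b h := by
    rintro _ ⟨z, rfl⟩
    refine ⟨TensorProduct.map (Submodule.inclusion (hG.mono h))
      (Submodule.inclusion (hG.mono h)) z, ?_⟩
    rw [← LinearMap.comp_apply, ← TensorProduct.map_comp]
    rfl
  mul_mem := by
    rintro a b _ ⟨z, rfl⟩ _ ⟨w, rfl⟩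
    induction z with
    | zero => rw [map_zero, zero_mul]; exact zero_mem _
    | add z z' h h' => rw [map_add, add_mul]; exact add_mem h h'
    | tmul x y =>
      induction w with
      | zero => rw [map_zero, mul_zero]; exact zero_mem _
      | add w w' h h' => rw [map_add, mul_add]; exact add_mem h h'
      | tmul x' y' =>
        exact ⟨⟨_, hG.mul_mem _ _ _ x.2 _ x'.2⟩ ⊗ₜ ⟨_, hG.mul_mem _ _ _ y.2 _ y'.2⟩, by simp⟩

end IsAlgebraFiltration

namespace GLCoord

variable (k : Type u) [Field k] (N : ℕ)

theorem coe_detUnit : ((detUnit k N : (GLCoord k N)ˣ) : GLCoord k N) = (X k N).det := rfl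

/-- The filtration of `O(GL_N)` is the smallest one with the coordinates in degree `1` and the
determinant and its inverse in degree `N`. -/
theorem map_filtration_mem {k : Type u} [Field k] {N : ℕ} {E : Type*} [CommRing E] [Algebra k E]
    {G : ℕ → Submodule k E} (hG : IsAlgebraFiltration G) (θ : GLCoord k N →ₐ[k] E)
    (hX : ∀ i j, θ (X k N i j) ∈ G 1) (hdet : θ (detUnit k N : (GLCoord k N)ˣ) ∈ G N)
    (hinv : θ ((detUnit k N)⁻¹ : (GLCoord k N)ˣ) ∈ G N) {d : ℕ} {x : GLCoord k N}
    (hx : x ∈ filtration k N d) : θ x ∈ G d := by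
  have hpoly : ∀ f, θ (ofPoly k N f) ∈ G f.totalDegree := by
    intro f
    have h1 : θ.comp (ofPoly k N) =
        MvPolynomial.aeval fun ij : Fin N × Fin N => θ (X k N ij.1 ij.2) := by
      ext ij
      simp [X]
    have h2 := DFunLike.congr_fun h1 f
    rw [AlgHom.comp_apply] at h2
    rw [h2]
    exact hG.aeval_mem (fun ij => hX _ _) f
  have hunit : ∀ i : ℤ, θ ((detUnit k N ^ i : (GLCoord k N)ˣ) : GLCoord k N) ∈
      G (i.natAbs * N) := by
    intro i
    obtain ⟨n, rfl | rfl⟩ := i.eq_nat_or_neg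
    · rw [zpow_natCast, Units.val_pow_eq_pow_val, map_pow, Int.natAbs_natCast]
      exact hG.pow_mem hdet n
    · rw [zpow_neg, zpow_natCast, ← inv_pow, Units.val_pow_eq_pow_val, map_pow, Int.natAbs_neg,
        Int.natAbs_natCast]
      exact hG.pow_mem hinv n
  have hle : filtration k N d ≤ (G d).comap θ.toLinearMap := by
    rw [filtration, Submodule.span_le]
    rintro _ ⟨f, i, hfi, rfl⟩
    change θ _ ∈ G d
    rw [map_mul]
    refine hG.mono ?_ (hG.mul_mem _ _ _ (hpoly f) _ (hunit i))
    rwa [mul_comm _ N]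
  exact hle hx

theorem isAlgebraFiltration : IsAlgebraFiltration (filtration k N) where
  one_mem := Submodule.subset_span ⟨1, 0, by simp, by simp⟩
  mono a b h := by
    refine Submodule.span_mono ?_
    rintro _ ⟨f, i, hfi, rfl⟩
    exact ⟨f, i, hfi.trans h, rfl⟩
  mul_mem a b x hx y hy := by
    have h : filtration k N a * filtration k N b ≤ filtration k N (a + b) := by
      rw [filtration, filtration, Submodule.span_mul_span, filtration]
      refine Submodule.span_mono ?_
      rintro _ ⟨_, ⟨f, i, hfi, rfl⟩, _, ⟨g, j, hgj, rfl⟩, rfl⟩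
      refine ⟨f * g, i + j, ?_, ?_⟩
      · have h1 := MvPolynomial.totalDegree_mul f g
        have h2 := Nat.mul_le_mul_left N (Int.natAbs_add_le i j)
        rw [mul_add] at h2
        omega
      · rw [map_mul, zpow_add, Units.val_mul]
        ring
    exact h (Submodule.mul_mem_mul hx hy)

theorem X_mem_filtration (i j : Fin N) : X k N i j ∈ filtration k N 1 :=
  Submodule.subset_span ⟨MvPolynomial.X (i, j), 0, by simp, by simp [X]⟩

theorem detUnit_zpow_mem_filtration (i : ℤ) :
    ((detUnit k N ^ i : (GLCoord k N)ˣ) : GLCoord k N) ∈ filtration k N (N * i.natAbs) :=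
  Submodule.subset_span ⟨1, i, by simp, by simp⟩

theorem exists_mem_filtration (x : GLCoord k N) : ∃ d, x ∈ filtration k N d := by
  obtain ⟨⟨f, ⟨_, n, rfl⟩⟩, h⟩ := IsLocalization.surj (Submonoid.powers (genericDet k N)) x
  refine ⟨_, Submodule.subset_span ⟨f, -(n : ℤ), le_rfl, ?_⟩⟩
  have h1 : x * ((detUnit k N ^ n : (GLCoord k N)ˣ) : GLCoord k N) = ofPoly k N f := by
    rw [Units.val_pow_eq_pow_val, coe_detUnit, det_X, ← map_pow]
    exact h
  rw [← h1, mul_assoc, ← Units.val_mul, zpow_neg, zpow_natCast, mul_inv_cancel, Units.val_one,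
    mul_one]

/-- The determinant is group-like. -/
theorem comul_detUnit : Bialgebra.comulAlgHom k (GLCoord k N) (detUnit k N : (GLCoord k N)ˣ) =
    ((detUnit k N : (GLCoord k N)ˣ) : GLCoord k N) ⊗ₜ[k]
      ((detUnit k N : (GLCoord k N)ˣ) : GLCoord k N) := by
  change comulHom k N (X k N).det = (X k N).det ⊗ₜ[k] (X k N).det
  have h : (comulHom k N).mapMatrix (X k N) = comulMatrix k N := lift_mapMatrix_X _ _
  rw [AlgHom.map_det, h, comulMatrix, Matrix.det_mul, ← AlgHom.map_det, ← AlgHom.map_det]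
  simp

theorem comul_detUnit_inv :
    Bialgebra.comulAlgHom k (GLCoord k N) ((detUnit k N)⁻¹ : (GLCoord k N)ˣ) =
    (((detUnit k N)⁻¹ : (GLCoord k N)ˣ) : GLCoord k N) ⊗ₜ[k]
      (((detUnit k N)⁻¹ : (GLCoord k N)ˣ) : GLCoord k N) := by
  have h1 : Bialgebra.comulAlgHom k (GLCoord k N) ((detUnit k N)⁻¹ : (GLCoord k N)ˣ) *
      Bialgebra.comulAlgHom k (GLCoord k N) (detUnit k N : (GLCoord k N)ˣ) = 1 := by
    rw [← map_mul, Units.inv_mul, map_one]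
  refine (left_inv_eq_right_inv h1 ?_)
  rw [comul_detUnit, Algebra.TensorProduct.tmul_mul_tmul, Units.mul_inv,
    Algebra.TensorProduct.one_def]

end GLCoord

section GroupFiltration

variable {k : Type u} [Field k] {A : Type u} [CommRing A] [HopfAlgebra k A] {N : ℕ}
  (φ : GLCoord k N →ₐc[k] A)

theorem isAlgebraFiltration_groupFiltration : IsAlgebraFiltration (groupFiltration φ) :=
  (GLCoord.isAlgebraFiltration k N).map (φ : GLCoord k N →ₐ[k] A)

theorem map_groupFiltration_mem {E : Type*} [CommRing E] [Algebra k E] {G : ℕ → Submodule k E}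
    (hG : IsAlgebraFiltration G) (θ : A →ₐ[k] E) (hX : ∀ i j, θ (φ (GLCoord.X k N i j)) ∈ G 1)
    (hdet : θ (φ (GLCoord.detUnit k N : (GLCoord k N)ˣ)) ∈ G N)
    (hinv : θ (φ ((GLCoord.detUnit k N)⁻¹ : (GLCoord k N)ˣ)) ∈ G N) {d : ℕ} {x : A}
    (hx : x ∈ groupFiltration φ d) : θ x ∈ G d := by
  obtain ⟨y, hy, rfl⟩ := hx
  exact GLCoord.map_filtration_mem hG (θ.comp (φ : GLCoord k N →ₐ[k] A)) hX hdet hinv hy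

theorem exists_groupFiltration_le_pow :
    ∃ V : Submodule k A, V.FG ∧ ∀ d, groupFiltration φ d ≤ V ^ d := by
  classical
  set a := φ (GLCoord.detUnit k N : (GLCoord k N)ˣ) with ha
  set b := φ ((GLCoord.detUnit k N)⁻¹ : (GLCoord k N)ˣ) with hb
  set y : Fin N × Fin N → A := fun ij => φ (GLCoord.X k N ij.1 ij.2) with hy
  set S : Finset A := {1, a, b} ∪ Finset.univ.image y with hS
  set V := Submodule.span k (S : Set A) with hV
  have hmem : ∀ a ∈ S, a ∈ V := fun a ha => Submodule.subset_span ha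
  have haV : a ∈ V := hmem a (by simp [hS])
  have hbV : b ∈ V := hmem b (by simp [hS])
  have hyV : ∀ ij, y ij ∈ V := fun ij =>
    hmem _ (Finset.mem_union_right _ (Finset.mem_image_of_mem y (Finset.mem_univ ij)))
  have hone : (1 : A) ∈ V := hmem 1 (by simp [hS])
  have hfil := IsAlgebraFiltration.pow_of_one_mem hone
  -- for `N = 0` the determinant has degree `0`, but then it is `1`
  have hpow : ∀ u : (GLCoord k N)ˣ, (N = 0 → u = 1) → φ (u : GLCoord k N) ∈ V →
      φ (u : GLCoord k N) ∈ V ^ N := by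
    intro u hu hmemu
    rcases Nat.eq_zero_or_pos N with h0 | hpos
    · rw [hu h0, Units.val_one, map_one, h0]
      exact hfil.one_mem
    · refine hfil.mono hpos ?_
      rwa [pow_one]
  have hdet : N = 0 → GLCoord.detUnit k N = 1 := by
    rintro rfl
    ext
    rw [GLCoord.coe_detUnit, Matrix.det_fin_zero, Units.val_one]
  refine ⟨V, ⟨S, rfl⟩, fun d x hx => map_groupFiltration_mem φ hfil (AlgHom.id k A) ?_ ?_ ?_ hx⟩
  · intro i j
    rw [pow_one]
    exact hyV (i, j)
  · exact hpow (GLCoord.detUnit k N) hdet haV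
  · exact hpow (GLCoord.detUnit k N)⁻¹ (fun h => inv_eq_one.2 (hdet h)) hbV

instance finite_groupFiltration (d : ℕ) : Module.Finite k (groupFiltration φ d) := by
  obtain ⟨V, hV, h⟩ := exists_groupFiltration_le_pow φ
  have : Module.Finite k (V ^ d : Submodule k A) := Module.Finite.iff_fg.2 (hV.pow d)
  exact Submodule.finiteDimensional_of_le (h d)

theorem exists_mem_groupFiltration {φ : GLCoord k N →ₐc[k] A} (hφ : Function.Surjective φ) (x : A) :
    ∃ d, x ∈ groupFiltration φ d := by
  obtain ⟨y, rfl⟩ := hφ x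
  obtain ⟨d, hd⟩ := GLCoord.exists_mem_filtration k N y
  exact ⟨d, y, hd, rfl⟩

theorem exists_forall_mem_groupFiltration {φ : GLCoord k N →ₐc[k] A} (hφ : Function.Surjective φ)
    {ι : Type*} [Finite ι] (x : ι → A) : ∃ d, ∀ i, x i ∈ groupFiltration φ d := by
  cases nonempty_fintype ι
  choose d hd using fun i => exists_mem_groupFiltration hφ (x i)
  exact ⟨Finset.univ.sup d, fun i => (isAlgebraFiltration_groupFiltration φ).mono
    (Finset.le_sup (Finset.mem_univ i)) (hd i)⟩

/-- Each step of the filtration is a subcoalgebra. -/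
theorem comul_mem_of_mem_groupFiltration {d : ℕ} {x : A} (hx : x ∈ groupFiltration φ d) :
    Coalgebra.comul (R := k) x ∈ LinearMap.range
      (TensorProduct.map (groupFiltration φ d).subtype (groupFiltration φ d).subtype) := by
  have hF := isAlgebraFiltration_groupFiltration φ
  have hmem : ∀ {d : ℕ} {a b : A}, a ∈ groupFiltration φ d → b ∈ groupFiltration φ d →
      a ⊗ₜ[k] b ∈ LinearMap.range
        (TensorProduct.map (groupFiltration φ d).subtype (groupFiltration φ d).subtype) :=
    fun ha hb => ⟨⟨_, ha⟩ ⊗ₜ ⟨_, hb⟩, rfl⟩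
  have hφΔ : ∀ y, Bialgebra.comulAlgHom k A (φ y) = Algebra.TensorProduct.map
      (φ : GLCoord k N →ₐ[k] A) (φ : GLCoord k N →ₐ[k] A)
      (Bialgebra.comulAlgHom k (GLCoord k N) y) := fun y =>
    (CoalgHomClass.map_comp_comul_apply φ y).symm
  have hzpow : ∀ u : (GLCoord k N)ˣ, (u : GLCoord k N) ∈ GLCoord.filtration k N N →
      φ (u : GLCoord k N) ∈ groupFiltration φ N := fun u hu => ⟨u, hu, rfl⟩
  have hdet := GLCoord.detUnit_zpow_mem_filtration k N 1
  have hinv := GLCoord.detUnit_zpow_mem_filtration k N (-1)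
  rw [zpow_one, Int.natAbs_one, mul_one] at hdet
  rw [zpow_neg, zpow_one, Int.natAbs_neg, Int.natAbs_one, mul_one] at hinv
  refine map_groupFiltration_mem φ hF.tensor (Bialgebra.comulAlgHom k A) ?_ ?_ ?_ hx
  · intro i j
    rw [hφΔ]
    change Algebra.TensorProduct.map _ _ (GLCoord.comulHom k N _) ∈ _
    rw [GLCoord.comulHom_X, map_sum]
    exact Submodule.sum_mem _ fun s _ => hmem ⟨_, GLCoord.X_mem_filtration k N i s, rfl⟩
      ⟨_, GLCoord.X_mem_filtration k N s j, rfl⟩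
  · rw [hφΔ, GLCoord.comul_detUnit]
    exact hmem (hzpow _ hdet) (hzpow _ hdet)
  · rw [hφΔ, GLCoord.comul_detUnit_inv]
    exact hmem (hzpow _ hinv) (hzpow _ hinv)

/-- The antipode distorts the filtration at most linearly. -/
theorem exists_antipode_mem_groupFiltration {φ : GLCoord k N →ₐc[k] A}
    (hφ : Function.Surjective φ) : ∃ L : ℕ, ∀ d, ∀ x ∈ groupFiltration φ d,
      HopfAlgebra.antipode k x ∈ groupFiltration φ (L * d) := by
  have hF := isAlgebraFiltration_groupFiltration φ
  let S := HopfAlgebra.antipodeAlgHom k A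
  obtain ⟨L₁, h₁⟩ := exists_forall_mem_groupFiltration hφ
    fun ij : Fin N × Fin N => S (φ (GLCoord.X k N ij.1 ij.2))
  obtain ⟨L₂, h₂⟩ := exists_mem_groupFiltration hφ
    (S (φ (GLCoord.detUnit k N : (GLCoord k N)ˣ)))
  obtain ⟨L₃, h₃⟩ := exists_mem_groupFiltration hφ
    (S (φ ((GLCoord.detUnit k N)⁻¹ : (GLCoord k N)ˣ)))
  set L := L₁ + L₂ + L₃
  have hpow : ∀ u : (GLCoord k N)ˣ, (N = 0 → u = 1) → S (φ (u : GLCoord k N)) ∈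
      groupFiltration φ L → S (φ (u : GLCoord k N)) ∈ groupFiltration φ (L * N) := by
    intro u hu hmemu
    rcases Nat.eq_zero_or_pos N with h0 | hpos
    · rw [hu h0, Units.val_one, map_one, map_one]
      exact hF.mono (Nat.zero_le _) hF.one_mem
    · exact hF.mono (Nat.le_mul_of_pos_right L hpos) hmemu
  have hdet : N = 0 → GLCoord.detUnit k N = 1 := by
    rintro rfl
    ext
    rw [GLCoord.coe_detUnit, Matrix.det_fin_zero, Units.val_one]
  refine ⟨L, fun d x hx => map_groupFiltration_mem φ (hF.comp_mul L) S ?_ ?_ ?_ hx⟩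
  · intro i j
    rw [mul_one]
    exact hF.mono (by omega) (h₁ (i, j))
  · exact hpow _ hdet (hF.mono (by omega) h₂)
  · exact hpow _ (fun h => inv_eq_one.2 (hdet h)) (hF.mono (by omega) h₃)

end GroupFiltration

/-! ### Functions on the quotient -/

/-- Faithfully flat descent for elements. -/
theorem mem_range_algebraMap_of_tmul_eq {R S : Type*} [CommRing R] [CommRing S] [Algebra R S]
    [Module.FaithfullyFlat R S] {s : S} (h : s ⊗ₜ[R] (1 : S) = 1 ⊗ₜ[R] s) :
    s ∈ Set.range (algebraMap R S) := by
  let Q := LinearMap.range (Algebra.linearMap R S)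
  have h1 := congrArg (LinearMap.lTensor S Q.mkQ) h
  have h2 : Q.mkQ (1 : S) = 0 := by
    rw [Submodule.mkQ_apply, Submodule.Quotient.mk_eq_zero]
    exact ⟨1, (algebraMap R S).map_one⟩
  rw [LinearMap.lTensor_tmul, LinearMap.lTensor_tmul, h2, TensorProduct.tmul_zero] at h1
  have h3 := (Module.FaithfullyFlat.one_tmul_eq_zero_iff R (S ⧸ Q) (A := S) (Q.mkQ s)).1 h1.symm
  rw [Submodule.mkQ_apply, Submodule.Quotient.mk_eq_zero] at h3
  exact h3

section Quotient

variable {k : Type u} [Field k] {A B C : Type u} [CommRing A] [HopfAlgebra k A]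
  [CommRing B] [HopfAlgebra k B] [CommRing C] [Algebra k C]

/-- The comorphism `A → A ⊗ B` of the right action `(g, h) ↦ g h` of `H` on `G`. -/
def rightAct (π : A →ₐc[k] B) : A →ₐ[k] A ⊗[k] B :=
  pointMul Algebra.TensorProduct.includeLeft
    ((Algebra.TensorProduct.includeRight : B →ₐ[k] A ⊗[k] B).comp (π : A →ₐ[k] B))

theorem pointMul_apply_of_rightAct_eq {π : A →ₐc[k] B} {f : A} (hf : rightAct π f = f ⊗ₜ 1)
    {R : Type u} [CommRing R] [Algebra k R] (g : A →ₐ[k] R) (h : B →ₐ[k] R) :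
    pointMul g (h.comp (π : A →ₐ[k] B)) f = g f := by
  let Θ : A ⊗[k] B →ₐ[k] R := Algebra.TensorProduct.lift g h (fun _ _ => Commute.all _ _)
  have h1 : Θ.comp (rightAct π) = pointMul g (h.comp (π : A →ₐ[k] B)) := by
    rw [rightAct, comp_pointMul]
    congr 1
    · ext a
      simp [Θ]
    · ext a
      simp [Θ]
  rw [← h1, AlgHom.comp_apply, hf]
  simp [Θ]

namespace IsAffineQuotient

variable {π : A →ₐc[k] B} {q : C →ₐ[k] A}

theorem rightAct_apply (hq : IsAffineQuotient π q) (c : C) : rightAct π (q c) = q c ⊗ₜ 1 := by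
  have h := (hq.fibre (A ⊗[k] B) Algebra.TensorProduct.includeLeft (rightAct π)).2 ⟨_, rfl⟩
  exact (DFunLike.congr_fun h c).symm

/-- The functions on `G/H` are exactly the right `H`-invariant functions on `G`: over a faithfully
flat `C → R'` with a section `g` of `G → G/H`, an invariant function `f` gives the element `g(f)`,
which descends to `C` since two sections differ by a point of `H`. -/
theorem mem_range_iff (hq : IsAffineQuotient π q) {f : A} :
    f ∈ q.range ↔ rightAct π f = f ⊗ₜ 1 := by
  refine ⟨?_, fun hf => ?_⟩
  · rintro ⟨c, rfl⟩
    exact hq.rightAct_apply c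
  obtain ⟨R', _, _, ι, g, hff, -, hg⟩ := hq.locally_lifts C (AlgHom.id k C)
  rw [AlgHom.comp_id] at hg
  let algCR : Algebra C R' := ι.toRingHom.toAlgebra
  let algCA : Algebra C A := q.toRingHom.toAlgebra
  have hι : ∀ c, algebraMap C R' c = ι c := fun _ => rfl
  have hqA : ∀ c, algebraMap C A c = q c := fun _ => rfl
  have hgq : ∀ c, g (q c) = ι c := fun c => DFunLike.congr_fun hg c
  have tower1 : IsScalarTower k C R' := IsScalarTower.of_algebraMap_eq fun r => by
    rw [hι, AlgHom.commutes]
  have tower2 : IsScalarTower k C A := IsScalarTower.of_algebraMap_eq fun r => by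
    rw [hqA, AlgHom.commutes]
  have hflat : Module.FaithfullyFlat C R' := hff
  have agree : ∀ {T : Type u} [CommRing T] [Algebra k T] (g₁ g₂ : A →ₐ[k] T),
      g₁.comp q = g₂.comp q → ∀ f, rightAct π f = f ⊗ₜ 1 → g₂ f = g₁ f := by
    intro T _ _ g₁ g₂ h f hf
    obtain ⟨h', rfl⟩ := (hq.fibre T g₁ g₂).1 h
    exact pointMul_apply_of_rightAct_eq hf g₁ h'
  -- the pullbacks of `g` to `R' ⊗ R'` differ by a point of `H`, so they agree on `f`
  obtain ⟨c, hc⟩ : g f ∈ Set.range (algebraMap C R') := by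
    refine mem_range_algebraMap_of_tmul_eq ?_
    let i₁ : R' →ₐ[k] R' ⊗[C] R' := Algebra.TensorProduct.includeLeft
    let i₂ : R' →ₐ[k] R' ⊗[C] R' :=
      (Algebra.TensorProduct.includeRight : R' →ₐ[C] R' ⊗[C] R').restrictScalars k
    refine (agree (i₂.comp g) (i₁.comp g) ?_ f hf)
    ext c
    change (1 : R') ⊗ₜ[C] g (q c) = g (q c) ⊗ₜ[C] (1 : R')
    rw [hgq, ← hι, Algebra.algebraMap_eq_smul_one, TensorProduct.smul_tmul]
  have hf' : rightAct π (f - q c) = (f - q c) ⊗ₜ 1 := by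
    rw [map_sub, hf, hq.rightAct_apply, TensorProduct.sub_tmul]
  have hgf' : g (f - q c) = 0 := by
    rw [map_sub, hgq, ← hι, hc, sub_self]
  -- over `R' ⊗ A` the section `g` and the tautological point of `G` lie over the same point of `G/H`
  have h0 : (1 : R') ⊗ₜ[C] (f - q c) = 0 := by
    let j₁ : R' →ₐ[k] R' ⊗[C] A := Algebra.TensorProduct.includeLeft
    let j₂ : A →ₐ[k] R' ⊗[C] A :=
      (Algebra.TensorProduct.includeRight : A →ₐ[C] R' ⊗[C] A).restrictScalars k
    have h1 := agree (j₁.comp g) j₂ (by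
      ext c
      change g (q c) ⊗ₜ[C] (1 : A) = (1 : R') ⊗ₜ[C] q c
      rw [hgq, ← hι, ← hqA, Algebra.algebraMap_eq_smul_one, Algebra.algebraMap_eq_smul_one,
        TensorProduct.smul_tmul]) _ hf'
    rw [AlgHom.comp_apply, hgf', map_zero] at h1
    exact h1
  have h1 := (Module.FaithfullyFlat.one_tmul_eq_zero_iff C A (A := R') (f - q c)).1 h0
  exact ⟨c, (sub_eq_zero.1 h1).symm⟩

/-- The functions on `G/H` are stable under left translations. -/
theorem tensorContractLeft_comul_mem (hq : IsAffineQuotient π q) {f : A} (hf : f ∈ q.range)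
    (μ : A →ₗ[k] k) : tensorContractLeft μ (Bialgebra.comulAlgHom k A f) ∈ q.range := by
  rw [hq.mem_range_iff] at hf ⊢
  let i : A →ₐ[k] A ⊗[k] B := Algebra.TensorProduct.includeLeft
  let p₁ : A →ₐ[k] A ⊗[k] (A ⊗[k] B) := Algebra.TensorProduct.includeLeft
  let p₂ : A ⊗[k] B →ₐ[k] A ⊗[k] (A ⊗[k] B) := Algebra.TensorProduct.includeRight
  have hmap : ∀ θ : A →ₐ[k] A ⊗[k] B, (Algebra.TensorProduct.map (AlgHom.id k A) θ).comp
      (Bialgebra.comulAlgHom k A) = pointMul p₁ (p₂.comp θ) := by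
    intro θ
    rw [comp_comulAlgHom]
    congr 1
    · ext a
      simp [p₁]
  have hcontract : ∀ (θ : A →ₐ[k] A ⊗[k] B) (z : A ⊗[k] A), tensorContractLeft μ
      (Algebra.TensorProduct.map (AlgHom.id k A) θ z) = θ (tensorContractLeft μ z) := by
    intro θ z
    induction z with
    | zero => simp
    | tmul a b => simp
    | add z z' h h' => simp only [map_add, h, h']
  -- in terms of points, this is the identity `f(g (g' h)) = f(g g')`
  have key : pointMul p₁ (p₂.comp (rightAct π)) f = pointMul p₁ (p₂.comp i) f := by
    rw [rightAct, comp_pointMul, ← pointMul_assoc, ← AlgHom.comp_assoc]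
    exact pointMul_apply_of_rightAct_eq hf _ _
  rw [← hmap, ← hmap] at key
  have h := congrArg (tensorContractLeft μ) key
  rw [AlgHom.comp_apply, AlgHom.comp_apply, hcontract, hcontract] at h
  exact h

/-- `H` is the fibre of `G → G/H` over the base point, so its ideal is generated by functions on
`G/H`. -/
theorem ker_le_span (hq : IsAffineQuotient π q) :
    RingHom.ker π ≤ Ideal.span {f | f ∈ q.range ∧ f ∈ augIdeal k A} := by
  set I := Ideal.span {f | f ∈ q.range ∧ f ∈ augIdeal k A}
  let mk : A →ₐ[k] A ⧸ I := Ideal.Quotient.mkₐ k I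
  -- modulo `I` the tautological point of `G` has the same image in `G/H` as the identity
  obtain ⟨h, hh⟩ := (hq.fibre (A ⧸ I) (pointOne _) mk).1 (by
    ext c
    change algebraMap k (A ⧸ I) (Bialgebra.counitAlgHom k A (q c)) = Ideal.Quotient.mk I (q c)
    rw [eq_comm, IsScalarTower.algebraMap_apply k A (A ⧸ I), Ideal.Quotient.algebraMap_eq,
      Ideal.Quotient.eq]
    refine Ideal.subset_span ⟨⟨c - algebraMap k C (Bialgebra.counitAlgHom k A (q c)), ?_⟩, ?_⟩
    · change q _ = _
      rw [map_sub, AlgHom.commutes]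
    · simp [RingHom.mem_ker])
  rw [pointOne_pointMul] at hh
  intro f hf
  rw [← Ideal.Quotient.eq_zero_iff_mem]
  change mk f = 0
  rw [hh, AlgHom.comp_apply]
  have : (π : A →ₐ[k] B) f = 0 := hf
  rw [this, map_zero]

/-- Lifts to `A` of linearly independent functions on `H` are linearly independent over `O(G/H)`:
evaluating suitable functionals on the translates along `H` gives a square matrix over `A` that is
the identity matrix at the identity element. -/
theorem eq_zero_of_sum_mul_eq_zero [IsDomain A] (hq : IsAffineQuotient π q) {ι : Type*} [Fintype ι]
    {l : ι → A} (hl : LinearIndependent k fun i => π (l i)) {c : ι → A} (hc : ∀ i, c i ∈ q.range)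
    (h : ∑ i, c i * l i = 0) : c = 0 := by
  classical
  have hdual : ∀ j, ∃ μ : B →ₗ[k] k, ∀ i, μ (π (l i)) = (1 : Matrix ι ι k) j i := by
    intro j
    obtain ⟨μ, hμ⟩ := LinearMap.exists_extend ((Module.Basis.span hl).coord j)
    refine ⟨μ, fun i => ?_⟩
    have h1 : π (l i) = (Submodule.subtype _) (Module.Basis.span hl i) := by
      rw [Submodule.subtype_apply, Module.Basis.span_apply]
    rw [h1, ← LinearMap.comp_apply, hμ, Module.Basis.coord_apply, Module.Basis.repr_self,
      Matrix.one_apply, Finsupp.single_apply]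
    simp [eq_comm]
  choose μ hμ using hdual
  let M : Matrix ι ι A := Matrix.of fun j i => tensorContractRight (μ j) (rightAct π (l i))
  have hεM : (Bialgebra.counitAlgHom k A).mapMatrix M = 1 := by
    ext j i
    have h1 : ∀ z : A ⊗[k] B, Bialgebra.counitAlgHom k A (tensorContractRight (μ j) z) =
        μ j (Algebra.TensorProduct.lift (pointOne B : A →ₐ[k] B) (AlgHom.id k B)
          (fun _ _ => Commute.all _ _) z) := by
      intro z
      induction z with
      | zero => simp
      | tmul a b =>
        simp only [tensorContractRight_tmul, map_smul, smul_eq_mul, Algebra.TensorProduct.lift_tmul,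
          AlgHom.id_apply, pointOne, AlgHom.comp_apply, Algebra.ofId_apply, ← Algebra.smul_def]
        exact mul_comm _ _
      | add z z' h h' => simp only [map_add, h, h']
    have h2 : (Algebra.TensorProduct.lift (pointOne B : A →ₐ[k] B) (AlgHom.id k B)
        (fun _ _ => Commute.all _ _)).comp (rightAct π) = (π : A →ₐ[k] B) := by
      rw [rightAct, comp_pointMul]
      have h3 : (Algebra.TensorProduct.lift (pointOne B : A →ₐ[k] B) (AlgHom.id k B)
          (fun _ _ => Commute.all _ _)).comp Algebra.TensorProduct.includeLeft = pointOne B := by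
        ext a
        simp
      rw [h3, pointOne_pointMul]
      ext a
      simp
    rw [← hμ]
    change Bialgebra.counitAlgHom k A (tensorContractRight (μ j) (rightAct π (l i))) = _
    rw [h1]
    congr 1
    exact DFunLike.congr_fun h2 (l i)
  have hdet : M.det ≠ 0 := by
    intro h0
    have h1 := congrArg (Bialgebra.counitAlgHom k A) h0
    rw [AlgHom.map_det, hεM, Matrix.det_one, map_zero] at h1
    exact one_ne_zero h1
  refine Matrix.eq_zero_of_mulVec_eq_zero hdet ?_
  ext j
  have h1 := congrArg (fun z => tensorContractRight (μ j) (rightAct π z)) h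
  simp only [map_sum, map_mul, map_zero] at h1
  rw [Pi.zero_apply, ← h1]
  refine Finset.sum_congr rfl fun i _ => ?_
  rw [hq.mem_range_iff.1 (hc i)]
  have h2 : ∀ z : A ⊗[k] B, tensorContractRight (μ j) (c i ⊗ₜ[k] 1 * z) =
      c i * tensorContractRight (μ j) z := by
    intro z
    induction z with
    | zero => simp
    | tmul a b => simp
    | add z z' h h' => simp only [mul_add, map_add, h, h']
  rw [h2, mul_comm]
  rfl

end IsAffineQuotient

/-! ### The regular part -/

theorem comul_antipode (f : A) : Bialgebra.comulAlgHom k A (HopfAlgebra.antipode k f) =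
    Algebra.TensorProduct.lift
      (pointInv (Algebra.TensorProduct.includeRight : A →ₐ[k] A ⊗[k] A))
      (pointInv (Algebra.TensorProduct.includeLeft : A →ₐ[k] A ⊗[k] A))
      (fun _ _ => Commute.all _ _) (Bialgebra.comulAlgHom k A f) := by
  have h1 := comp_comulAlgHom (AlgHom.id k (A ⊗[k] A))
  rw [AlgHom.id_comp, AlgHom.id_comp, AlgHom.id_comp] at h1
  have h2 := congrArg pointInv h1
  rw [pointInv_pointMul_rev] at h2
  exact DFunLike.congr_fun h2 f

theorem tensorContractRight_comul_antipode (μ : A →ₗ[k] k) (f : A) :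
    tensorContractRight μ (Bialgebra.comulAlgHom k A (HopfAlgebra.antipode k f)) =
      HopfAlgebra.antipode k (tensorContractLeft (μ ∘ₗ HopfAlgebra.antipode k)
        (Bialgebra.comulAlgHom k A f)) := by
  rw [comul_antipode]
  generalize Bialgebra.comulAlgHom k A f = z
  induction z with
  | zero => simp
  | tmul a b => simp [pointInv]
  | add z z' h h' => simp only [map_add, h, h']

theorem mem_range_map_inf_subtype {M F : Submodule k A} {z : A ⊗[k] A}
    (hz : z ∈ LinearMap.range (TensorProduct.map F.subtype F.subtype))
    (hM : ∀ μ : A →ₗ[k] k, tensorContractRight μ z ∈ M) :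
    z ∈ LinearMap.range (TensorProduct.map (M ⊓ F).subtype F.subtype) := by
  obtain ⟨w, rfl⟩ := hz
  let b := Module.Basis.ofVectorSpace k F
  obtain ⟨s, hs⟩ := eq_sum_tensorContractRight_tmul b w
  have hmem : ∀ i, ((tensorContractRight (b.coord i) w : F) : A) ∈ M := by
    intro i
    obtain ⟨μ, hμ⟩ := LinearMap.exists_extend (b.coord i)
    have h1 : ∀ w : F ⊗[k] F, ((tensorContractRight (b.coord i) w : F) : A) =
        tensorContractRight μ (TensorProduct.map F.subtype F.subtype w) := by
      intro w
      induction w with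
      | zero => simp
      | tmul x y =>
        rw [TensorProduct.map_tmul, tensorContractRight_tmul, tensorContractRight_tmul, ← hμ]
        rfl
      | add w w' h h' => simp only [map_add, Submodule.coe_add, h, h']
    rw [h1]
    exact hM μ
  rw [hs, map_sum]
  refine Submodule.sum_mem _ fun i _ => ?_
  exact ⟨⟨_, hmem i, (tensorContractRight (b.coord i) w).2⟩ ⊗ₜ b i, rfl⟩

/-- Since `F` is a subcoalgebra, the largest submodule of `k[G/H]^R` with coefficients in `F` is the
intersection with `F`. -/
theorem regularPart_quotientRight {π : A →ₐc[k] B} {q : C →ₐ[k] A} (hq : IsAffineQuotient π q)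
    {F : Submodule k A} (hF : ∀ x ∈ F, Coalgebra.comul (R := k) x ∈
      LinearMap.range (TensorProduct.map F.subtype F.subtype)) :
    regularPart (quotientRight q) F = quotientRight q ⊓ F := by
  refine le_antisymm (sSup_le ?_) (le_sSup ⟨inf_le_left, ?_⟩)
  · rintro N ⟨hNM, hN⟩
    refine le_inf hNM fun x hx => ?_
    obtain ⟨w, hw⟩ := hN (Submodule.mem_map_of_mem hx)
    have h1 : tensorContractLeft (Coalgebra.counit (R := k) (A := A)) (Coalgebra.comul x) = x := by
      simp [tensorContractLeft]
    rw [← h1, ← hw]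
    generalize w = w'
    induction w' with
    | zero => simp
    | tmul a b => simpa using F.smul_mem _ b.2
    | add w w' h h' => rw [map_add, map_add]; exact add_mem h h'
  · rw [Submodule.map_le_iff_le_comap]
    rintro x ⟨⟨y, hy, rfl⟩, hxF⟩
    refine mem_range_map_inf_subtype (hF _ hxF) fun μ => ?_
    change tensorContractRight μ (Bialgebra.comulAlgHom k A (HopfAlgebra.antipode k y)) ∈ _
    rw [tensorContractRight_comul_antipode]
    exact Submodule.mem_map_of_mem (hq.tensorContractLeft_comul_mem hy _)

end Quotient

/-! ### Coordinates adapted to a subgroup -/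

section CotangentSpace

variable {k A : Type*} [Field k] [CommRing A] [Algebra k A]

theorem cotangentClass_sub_algebraMap (ε : A →ₐ[k] k) (a : A) (c : k) :
    cotangentClass ε (a - algebraMap k A c) = cotangentClass ε a := by
  simp only [cotangentClass, LinearMap.coe_mk, AddHom.coe_mk]
  congr 2
  simp

theorem exists_mem_ker_cotangentClass_eq (ε : A →ₐ[k] k) (z : (RingHom.ker ε).Cotangent) :
    ∃ a ∈ RingHom.ker ε, cotangentClass ε a = z := by
  obtain ⟨⟨a, ha⟩, rfl⟩ := Ideal.toCotangent_surjective _ z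
  exact ⟨a, ha, cotangentClass_of_mem ε ha⟩

theorem cotangentClass_eq_zero_of_mem_sq (ε : A →ₐ[k] k) {a : A} (ha : a ∈ RingHom.ker ε ^ 2) :
    cotangentClass ε a = 0 := by
  rw [cotangentClass_of_mem ε (Ideal.pow_le_self two_ne_zero ha), Ideal.toCotangent_eq_zero]
  exact ha

theorem cotangentClass_mem_span {ε : A →ₐ[k] k} {s : Set A} (hs : s ⊆ RingHom.ker ε) {a : A}
    (ha : a ∈ Ideal.span s) : cotangentClass ε a ∈ Submodule.span k (cotangentClass ε '' s) := by
  induction ha using Submodule.span_induction with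
  | mem a ha => exact Submodule.subset_span ⟨a, ha, rfl⟩
  | zero => rw [map_zero]; exact zero_mem _
  | add a b _ _ h h' => rw [map_add]; exact add_mem h h'
  | smul c a ha h =>
    have h0 : ε a = 0 := Ideal.span_le.2 hs ha
    rw [smul_eq_mul, cotangentClass_mul, h0, zero_smul, add_zero]
    exact Submodule.smul_mem _ _ h

instance finite_cotangent_ker [IsNoetherianRing A] (ε : A →ₐ[k] k) :
    Module.Finite k (RingHom.ker ε).Cotangent := by
  obtain ⟨s, hs⟩ := IsNoetherian.noetherian (RingHom.ker ε)
  refine Module.finite_def.2 (Submodule.fg_def.2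
    ⟨cotangentClass ε '' s, s.finite_toSet.image _, eq_top_iff.2 fun z _ => ?_⟩)
  obtain ⟨a, ha, rfl⟩ := exists_mem_ker_cotangentClass_eq ε z
  rw [← hs] at ha
  exact cotangentClass_mem_span (hs ▸ Ideal.subset_span) ha

theorem exists_isCoordinateSystem {σ : Type*} [Finite σ] {ε : A →ₐ[k] k}
    (b : Module.Basis σ k (RingHom.ker ε).Cotangent) : ∃ x : σ → A, IsCoordinateSystem ε x := by
  choose x hx hxb using fun i => exists_mem_ker_cotangentClass_eq ε (b i)
  exact ⟨x, isCoordinateSystem_of_basis b hx hxb⟩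

end CotangentSpace

section HopfCoordinates

variable {k : Type u} [Field k] {A B C : Type u} [CommRing A] [HopfAlgebra k A]
  [CommRing B] [HopfAlgebra k B] [CommRing C] [Algebra k C]

theorem finrank_lieSpace :
    Module.finrank k (LieSpace k A) = Module.finrank k (augIdeal k A).Cotangent :=
  Subspace.dual_finrank_eq

theorem isNoetherianRing_of_smooth (k A : Type*) [Field k] [CommRing A] [Algebra k A]
    [Algebra.Smooth k A] : IsNoetherianRing A :=
  Algebra.FiniteType.isNoetherianRing k A

/-- Coordinates at the identity of a smooth connected group embed its functions in a power series
ring. -/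
theorem IsCoordinateSystem.exists_injective_algHom {σ : Type*} [LinearOrder σ] [Fintype σ]
    [Algebra.Smooth k A] [ConnectedSpace (PrimeSpectrum A)] {x : σ → A}
    (hx : IsCoordinateSystem (Bialgebra.counitAlgHom k A) x) :
    ∃ ψ : A →ₐ[k] MvPowerSeries σ k, Function.Injective ψ ∧
      ∀ i, IsInitExp MonomialOrder.degLex (ψ (x i)) (Finsupp.single i 1) := by
  have := isNoetherianRing_of_smooth k A
  obtain ⟨ψ, hε, hψ⟩ := hx.exists_algHom
  refine ⟨ψ, (injective_iff_map_eq_zero ψ).2 fun a ha => ?_, hψ⟩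
  exact eq_zero_of_forall_mem_augIdeal_pow fun j => hx.mem_ker_pow_of_map_eq_zero hε hψ ha j

theorem isDomain_of_smooth_of_connected (k : Type u) [Field k] (A : Type u) [CommRing A]
    [HopfAlgebra k A] [Algebra.Smooth k A] [ConnectedSpace (PrimeSpectrum A)] : IsDomain A := by
  have := isNoetherianRing_of_smooth k A
  obtain ⟨x, hx⟩ := exists_isCoordinateSystem (Module.finBasis k (augIdeal k A).Cotangent)
  obtain ⟨ψ, hψ, -⟩ := hx.exists_injective_algHom
  have := NoZeroDivisors.to_isDomain
    (MvPowerSeries (Fin (Module.finrank k (augIdeal k A).Cotangent)) k)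
  exact hψ.isDomain ψ.toRingHom

/-- The map induced on cotangent spaces at the identity by a homomorphism of groups. -/
def cotangentMap (π : A →ₐc[k] B) : (augIdeal k A).Cotangent →ₗ[k] (augIdeal k B).Cotangent :=
  Ideal.mapCotangent _ _ (π : A →ₐ[k] B) fun a ha => by
    have h : Coalgebra.counit (R := k) a = 0 := ha
    simpa [RingHom.mem_ker] using h

theorem counitAlgHom_map (π : A →ₐc[k] B) (a : A) :
    Bialgebra.counitAlgHom k B (π a) = Bialgebra.counitAlgHom k A a := by
  simp

theorem cotangentMap_cotangentClass (π : A →ₐc[k] B) (a : A) :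
    cotangentMap π (cotangentClass (Bialgebra.counitAlgHom k A) a) =
      cotangentClass (Bialgebra.counitAlgHom k B) (π a) := by
  rw [← cotangentClass_sub_algebraMap _ a (Bialgebra.counitAlgHom k A a),
    ← cotangentClass_sub_algebraMap _ (π a) (Bialgebra.counitAlgHom k A a),
    cotangentClass_of_mem _ (by simp [RingHom.mem_ker]),
    cotangentClass_of_mem _ (by simp [RingHom.mem_ker]), cotangentMap, Ideal.mapCotangent_toCotangent]
  congr 2
  exact (map_sub π a _).trans
    (congrArg (π a - ·) ((π : A →ₐ[k] B).commutes (Bialgebra.counitAlgHom k A a)))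

theorem cotangentMap_surjective {π : A →ₐc[k] B} (hπ : Function.Surjective π) :
    Function.Surjective (cotangentMap π) := by
  intro z
  obtain ⟨b, -, rfl⟩ := exists_mem_ker_cotangentClass_eq _ z
  obtain ⟨a, rfl⟩ := hπ b
  exact ⟨_, cotangentMap_cotangentClass π a⟩

theorem augIdeal_le_map {π : A →ₐc[k] B} (hπ : Function.Surjective π) :
    augIdeal k B ≤ (augIdeal k A).map π := by
  intro b hb
  obtain ⟨a, rfl⟩ := hπ b
  refine Ideal.mem_map_of_mem _ ?_
  rw [RingHom.mem_ker, ← counitAlgHom_map π]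
  exact hb

/-- Cotangent vectors of `G` that vanish on `H` come from functions on `G/H`. -/
theorem IsAffineQuotient.ker_cotangentMap_le {π : A →ₐc[k] B} (hπ : Function.Surjective π)
    {q : C →ₐ[k] A} (hq : IsAffineQuotient π q) : LinearMap.ker (cotangentMap π) ≤
      q.range.toSubmodule.map (cotangentClass (Bialgebra.counitAlgHom k A)) := by
  intro z hz
  obtain ⟨a, ha, rfl⟩ := exists_mem_ker_cotangentClass_eq _ z
  have hb : π a ∈ augIdeal k B := by
    rw [RingHom.mem_ker, counitAlgHom_map π]
    exact ha
  rw [LinearMap.mem_ker, cotangentMap_cotangentClass, cotangentClass_of_mem _ hb,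
    Ideal.toCotangent_eq_zero] at hz
  have h1 := Ideal.pow_right_mono (augIdeal_le_map hπ) 2 hz
  rw [← Ideal.map_pow] at h1
  obtain ⟨a₂, ha₂, h2⟩ := (Ideal.mem_map_iff_of_surjective π hπ).1 h1
  have h3 : a - a₂ ∈ RingHom.ker π := by
    rw [RingHom.mem_ker, map_sub, h2, sub_self]
  have h4 := cotangentClass_mem_span (ε := Bialgebra.counitAlgHom k A) (fun f hf => hf.2)
    (hq.ker_le_span h3)
  rw [map_sub, cotangentClass_eq_zero_of_mem_sq _ ha₂, sub_zero, ← Submodule.map_span] at h4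
  exact Submodule.map_mono (Submodule.span_le.2 fun f hf => hf.1) h4

/-- There are coordinates of `G` at the identity of which the first ones are functions on `G/H`
and the others restrict to coordinates of `H`. -/
theorem IsAffineQuotient.exists_coordinates [IsNoetherianRing A] [IsNoetherianRing B]
    {π : A →ₐc[k] B} (hπ : Function.Surjective π) {q : C →ₐ[k] A} (hq : IsAffineQuotient π q) :
    ∃ (e h : ℕ) (x : Fin (e + h) → A), Module.finrank k (LieSpace k A) = e + h ∧
      Module.finrank k (LieSpace k B) = h ∧ IsCoordinateSystem (Bialgebra.counitAlgHom k A) x ∧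
      (∀ i : Fin e, x (Fin.castAdd h i) ∈ q.range) ∧
      IsCoordinateSystem (Bialgebra.counitAlgHom k B) fun j : Fin h => π (x (Fin.natAdd e j)) := by
  set D := cotangentMap π
  let E := D.quotKerEquivOfSurjective (cotangentMap_surjective hπ)
  let bK := Module.finBasis k (LinearMap.ker D)
  let bB := Module.finBasis k (augIdeal k B).Cotangent
  let bs := Module.Basis.sumQuot bK (bB.map E.symm)
  have hD : ∀ j, D (bs (Sum.inr j)) = bB j := by
    intro j
    have h1 := Module.Basis.sumQuot_inr bK (bB.map E.symm) j
    have h2 := congrArg E h1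
    rw [Module.Basis.map_apply, LinearEquiv.apply_symm_apply] at h2
    exact h2
  have hlift : ∀ i, ∃ a ∈ augIdeal k A, cotangentClass (Bialgebra.counitAlgHom k A) a = bs i ∧
      ∀ j, i = Sum.inl j → a ∈ q.range := by
    rintro (i | j)
    · have h1 : bs (Sum.inl i) ∈ LinearMap.ker D := by
        rw [Module.Basis.sumQuot_inl]
        exact (bK i).2
      obtain ⟨f, hf, hfi⟩ := hq.ker_cotangentMap_le hπ h1
      refine ⟨f - algebraMap k A (Bialgebra.counitAlgHom k A f), by simp [RingHom.mem_ker], ?_, ?_⟩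
      · rw [cotangentClass_sub_algebraMap, hfi]
      · exact fun _ _ => sub_mem hf (q.range.algebraMap_mem _)
    · obtain ⟨a, ha, h1⟩ := exists_mem_ker_cotangentClass_eq _ (bs (Sum.inr j))
      exact ⟨a, ha, h1, fun _ h => by simp at h⟩
  choose a ha hab haq using hlift
  let b := bs.reindex finSumFinEquiv
  refine ⟨_, _, fun i => a (finSumFinEquiv.symm i), ?_, ?_, ?_, ?_, ?_⟩
  · rw [finrank_lieSpace, Module.finrank_eq_card_basis b, Fintype.card_fin]
  · exact finrank_lieSpace
  · refine isCoordinateSystem_of_basis b (fun i => ha _) fun i => ?_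
    rw [hab, Module.Basis.reindex_apply]
  · intro i
    dsimp only
    rw [finSumFinEquiv_symm_apply_castAdd]
    exact haq _ i rfl
  · refine isCoordinateSystem_of_basis bB (fun j => ?_) fun j => ?_
    · rw [counitAlgHom_map]
      exact ha _
    · dsimp only
      rw [finSumFinEquiv_symm_apply_natAdd, ← cotangentMap_cotangentClass, hab]
      exact hD j

end HopfCoordinates

/-! ### Growth of the filtrations -/

section Growth

variable {k : Type u} [Field k] {A B C : Type u} [CommRing A] [HopfAlgebra k A]
  [CommRing B] [HopfAlgebra k B] [CommRing C] [Algebra k C]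
  [Algebra.Smooth k A] [ConnectedSpace (PrimeSpectrum A)] {N : ℕ}

theorem exists_finrank_groupFiltration_le (φ : GLCoord k N →ₐc[k] A) {n : ℕ} {x : Fin n → A}
    (hx : IsCoordinateSystem (Bialgebra.counitAlgHom k A) x) :
    ∃ D : ℕ, ∀ d, 1 ≤ d → Module.finrank k (groupFiltration φ d) ≤ D * d ^ n := by
  have := isDomain_of_smooth_of_connected k A
  obtain ⟨ψ, -, hψ⟩ := hx.exists_injective_algHom
  obtain ⟨V, hV, hle⟩ := exists_groupFiltration_le_pow φ
  obtain ⟨D, hD⟩ := hx.exists_finrank_pow_le (algebraicIndependent_of_isInitExp hψ) hV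
  refine ⟨D, fun d hd => ?_⟩
  have : Module.Finite k (V ^ d : Submodule k A) := Module.Finite.iff_fg.2 (hV.pow d)
  have h := hD d hd
  rw [Fintype.card_fin] at h
  exact (Submodule.finrank_mono (hle d)).trans h

theorem hasPolynomialGrowth_groupFiltration {φ : GLCoord k N →ₐc[k] A}
    (hφ : Function.Surjective φ) :
    HasPolynomialGrowth (fun d => Module.finrank k (groupFiltration φ d))
      (Module.finrank k (LieSpace k A)) := by
  have := isNoetherianRing_of_smooth k A
  obtain ⟨x, hx⟩ := exists_isCoordinateSystem (Module.finBasis k (augIdeal k A).Cotangent)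
  obtain ⟨D, hD⟩ := exists_finrank_groupFiltration_le φ hx
  obtain ⟨K, hK⟩ := exists_forall_mem_groupFiltration hφ x
  obtain ⟨ψ, hinj, hψ⟩ := hx.exists_injective_algHom
  have hF := isAlgebraFiltration_groupFiltration φ
  have h := hasPolynomialGrowth_finrank ψ hinj hF.one_mem hF.mono hF.mul_mem (T := Finset.univ)
    (fun i _ => ⟨x i, hK i, hψ i⟩) (C := D) (by rwa [Finset.card_univ, Fintype.card_fin])
  rwa [Finset.card_univ, Fintype.card_fin, ← finrank_lieSpace] at h

variable [Algebra.Smooth k B] [ConnectedSpace (PrimeSpectrum B)]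

/-- The upper bound for `G/H`: multiplication by the monomials in coordinates of `H` embeds about
`d ^ dim H` copies of the functions of degree `d` on `G/H` in the functions on `G` of degree
`O(d)`. -/
theorem IsAffineQuotient.exists_finrank_inf_le {φ : GLCoord k N →ₐc[k] A}
    (hφ : Function.Surjective φ) {π : A →ₐc[k] B} {q : C →ₐ[k] A} (hq : IsAffineQuotient π q)
    {e h : ℕ} {x : Fin (e + h) → A} (hx : IsCoordinateSystem (Bialgebra.counitAlgHom k A) x)
    (hxB : IsCoordinateSystem (Bialgebra.counitAlgHom k B)
      fun j : Fin h => π (x (Fin.natAdd e j))) :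
    ∃ D : ℕ, ∀ d, 1 ≤ d →
      Module.finrank k (q.range.toSubmodule ⊓ groupFiltration φ d : Submodule k A) ≤ D * d ^ e := by
  have := isDomain_of_smooth_of_connected k A
  have hF := isAlgebraFiltration_groupFiltration φ
  obtain ⟨D, hD⟩ := exists_finrank_groupFiltration_le φ hx
  set y : Fin h → A := fun j => x (Fin.natAdd e j) with hy
  obtain ⟨K, hK⟩ := exists_forall_mem_groupFiltration hφ y
  obtain ⟨ψ, -, hψ⟩ := hxB.exists_injective_algHom
  have hind := linearIndependent_monomialIn hψ
  refine ⟨D * (1 + h * K) ^ (e + h), fun d hd => ?_⟩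
  let box : Finset (Fin h →₀ ℕ) := exponentBox Finset.univ d
  have hbox : ∀ u ∈ box, u.degree ≤ h * d := by
    intro u hu
    rw [mem_exponentBox] at hu
    rw [Finsupp.degree_eq_sum]
    refine (Finset.sum_le_card_nsmul _ _ d fun i _ => ?_).trans (by simp)
    exact (by simpa using hu i : u i < d).le
  let W : Submodule k A := q.range.toSubmodule ⊓ groupFiltration φ d
  have hW : Module.Finite k W := Submodule.finiteDimensional_of_le inf_le_right
  let Θ : (box → W) →ₗ[k] A :=
    ∑ u : box, LinearMap.mulRight k (monomialIn y u.1) ∘ₗ W.subtype ∘ₗ LinearMap.proj u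
  have hΘ : ∀ c, Θ c = ∑ u : box, (c u : A) * monomialIn y u.1 := fun c => by
    simp [Θ]
  have hmem : ∀ c, Θ c ∈ groupFiltration φ ((1 + h * K) * d) := by
    intro c
    rw [hΘ]
    refine Submodule.sum_mem _ fun u _ => ?_
    refine hF.mono ?_ (hF.mul_mem _ _ _ (c u).2.2 _ (hF.monomialIn_mem hK u.1))
    have := Nat.mul_le_mul_right K (hbox u u.2)
    linarith
  have hinj : Function.Injective (Θ.codRestrict _ hmem) := by
    rw [injective_iff_map_eq_zero]
    intro c hc
    have h0 : ∑ u : box, (c u : A) * monomialIn y u.1 = 0 := by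
      rw [← hΘ]
      exact congrArg Subtype.val hc
    have h1 := hq.eq_zero_of_sum_mul_eq_zero (l := fun u : box => monomialIn y u.1) (by
      simp only [map_monomialIn]
      exact hind.comp _ Subtype.val_injective) (fun u => (c u).2.1) h0
    ext u
    exact congrFun h1 u
  have h1 := LinearMap.finrank_le_finrank_of_injective hinj
  rw [Module.finrank_pi_fintype, Finset.sum_const, Finset.card_univ, Fintype.card_coe,
    card_exponentBox, Finset.card_univ, Fintype.card_fin, smul_eq_mul] at h1
  have h2 := h1.trans (hD _ (Nat.mul_pos (by omega) hd))
  rw [mul_pow, pow_add d, ← mul_assoc, ← mul_assoc, mul_comm] at h2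
  exact Nat.le_of_mul_le_mul_right h2 (Nat.pow_pos hd)

theorem card_map_castAdd (e h : ℕ) :
    ((Finset.univ : Finset (Fin e)).map (Fin.castAddEmb h)).card = e := by
  simp

theorem IsAffineQuotient.hasPolynomialGrowth_inf {φ : GLCoord k N →ₐc[k] A}
    (hφ : Function.Surjective φ) {π : A →ₐc[k] B} {q : C →ₐ[k] A} (hq : IsAffineQuotient π q)
    {e h : ℕ} {x : Fin (e + h) → A} (hx : IsCoordinateSystem (Bialgebra.counitAlgHom k A) x)
    (hxq : ∀ i : Fin e, x (Fin.castAdd h i) ∈ q.range)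
    (hxB : IsCoordinateSystem (Bialgebra.counitAlgHom k B)
      fun j : Fin h => π (x (Fin.natAdd e j))) :
    HasPolynomialGrowth (fun d =>
      Module.finrank k (q.range.toSubmodule ⊓ groupFiltration φ d : Submodule k A)) e := by
  obtain ⟨D, hD⟩ := hq.exists_finrank_inf_le hφ hx hxB
  obtain ⟨K, hK⟩ := exists_forall_mem_groupFiltration hφ x
  obtain ⟨ψ, hinj, hψ⟩ := hx.exists_injective_algHom
  have hW := (isAlgebraFiltration_groupFiltration φ).inf q.range
  have hfin : ∀ d, Module.Finite k (q.range.toSubmodule ⊓ groupFiltration φ d : Submodule k A) :=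
    fun d => Submodule.finiteDimensional_of_le inf_le_right
  have h := hasPolynomialGrowth_finrank ψ hinj hW.one_mem hW.mono hW.mul_mem
    (T := Finset.univ.map (Fin.castAddEmb h)) (K := K) (m := MonomialOrder.degLex) (fun i hi => by
      obtain ⟨j, -, rfl⟩ := Finset.mem_map.1 hi
      exact ⟨_, ⟨hxq j, hK _⟩, hψ _⟩) (C := D) (by rwa [card_map_castAdd])
  rwa [card_map_castAdd] at h

/-- The right regular version: the antipode carries it to the preceding one, up to rescaling the
filtration, so that the upper bound is inherited. -/
theorem IsAffineQuotient.hasPolynomialGrowth_regularPart {φ : GLCoord k N →ₐc[k] A}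
    (hφ : Function.Surjective φ) {π : A →ₐc[k] B} {q : C →ₐ[k] A} (hq : IsAffineQuotient π q)
    {e h : ℕ} {x : Fin (e + h) → A} (hx : IsCoordinateSystem (Bialgebra.counitAlgHom k A) x)
    (hxq : ∀ i : Fin e, x (Fin.castAdd h i) ∈ q.range)
    (hxB : IsCoordinateSystem (Bialgebra.counitAlgHom k B)
      fun j : Fin h => π (x (Fin.natAdd e j))) :
    HasPolynomialGrowth (fun d =>
      Module.finrank k (regularPart (quotientRight q) (groupFiltration φ d))) e := by
  have heq : (fun d => regularPart (quotientRight q) (groupFiltration φ d)) =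
      fun d => quotientRight q ⊓ groupFiltration φ d := funext fun d =>
    regularPart_quotientRight hq fun y hy => comul_mem_of_mem_groupFiltration φ hy
  change HasPolynomialGrowth
    (fun d => Module.finrank k ((fun d => regularPart (quotientRight q) (groupFiltration φ d)) d)) e
  rw [heq]
  let S := HopfAlgebra.antipodeAlgHom k A
  have hSS : ∀ a, S (S a) = a := antipode_antipode
  have hSinj : Function.Injective S := Function.LeftInverse.injective hSS
  obtain ⟨D, hD⟩ := hq.exists_finrank_inf_le hφ hx hxB
  obtain ⟨L, hL⟩ := exists_antipode_mem_groupFiltration hφ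
  obtain ⟨K, hK⟩ := exists_forall_mem_groupFiltration hφ fun i => S (x i)
  obtain ⟨ψ, hinj, hψ⟩ := hx.exists_injective_algHom
  have hF := isAlgebraFiltration_groupFiltration φ
  have hW := hF.inf (q.range.map S)
  have hfin : ∀ d, Module.Finite k (quotientRight q ⊓ groupFiltration φ d : Submodule k A) :=
    fun d => Submodule.finiteDimensional_of_le inf_le_right
  have hfin' : ∀ d, Module.Finite k (q.range.toSubmodule ⊓ groupFiltration φ d : Submodule k A) :=
    fun d => Submodule.finiteDimensional_of_le inf_le_right
  have hbound : ∀ d, 1 ≤ d → Module.finrank k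
      (quotientRight q ⊓ groupFiltration φ d : Submodule k A) ≤ D * (L + 1) ^ e * d ^ e := by
    intro d hd
    let j : (quotientRight q ⊓ groupFiltration φ d : Submodule k A) →ₗ[k]
        (q.range.toSubmodule ⊓ groupFiltration φ ((L + 1) * d) : Submodule k A) :=
      (S.toLinearMap ∘ₗ Submodule.subtype _).codRestrict _ (by
        rintro ⟨_, ⟨y, hy, rfl⟩, hyF⟩
        refine ⟨?_, hF.mono (Nat.mul_le_mul_right d (Nat.le_succ L)) (hL d _ hyF)⟩
        have : S (S y) ∈ q.range := by
          rw [hSS]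
          exact hy
        exact this)
    have hj : Function.Injective j := fun v w hvw =>
      Subtype.ext (hSinj (congrArg Subtype.val hvw))
    refine (LinearMap.finrank_le_finrank_of_injective hj).trans
      ((hD _ (Nat.mul_pos L.succ_pos hd)).trans ?_)
    rw [mul_pow, mul_assoc]
  -- the embedding `ψ ∘ S` has the functions `S (x i)` as coordinates
  have h := hasPolynomialGrowth_finrank (W := fun d => quotientRight q ⊓ groupFiltration φ d)
    (ψ.comp S) (hinj.comp hSinj) hW.one_mem hW.mono hW.mul_mem
    (T := Finset.univ.map (Fin.castAddEmb h)) (K := K) (m := MonomialOrder.degLex) (fun i hi => by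
      obtain ⟨j, -, rfl⟩ := Finset.mem_map.1 hi
      refine ⟨S (x (Fin.castAdd h j)), ⟨⟨_, hxq j, rfl⟩, hK _⟩, ?_⟩
      rw [AlgHom.comp_apply, hSS]
      exact hψ _) (C := D * (L + 1) ^ e) (by rwa [card_map_castAdd])
  rwa [card_map_castAdd] at h

end Growth

end

theorem mainTheorem9 {k : Type u} [Field k] (p : ℕ) [Fact p.Prime] [CharP k p]
    {A : Type u} [CommRing A] [HopfAlgebra k A] [Algebra.Smooth k A]
    [ConnectedSpace (PrimeSpectrum A)]
    {N : ℕ} (φ : GLCoord k N →ₐc[k] A) (hφ : Function.Surjective φ) :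
    HasPolynomialGrowth (fun d => Module.finrank k (groupFiltration φ d))
        (Module.finrank k (LieSpace k A)) ∧
      ∀ (B C : Type u) [CommRing B] [HopfAlgebra k B] [Algebra.Smooth k B]
        [ConnectedSpace (PrimeSpectrum B)] [CommRing C] [Algebra k C]
        (π : A →ₐc[k] B) (_ : Function.Surjective π) (q : C →ₐ[k] A)
        (_ : IsAffineQuotient π q),
        Module.finrank k (LieSpace k B) ≤ Module.finrank k (LieSpace k A) ∧
        HasPolynomialGrowth
          (fun d => Module.finrank k (regularPart (quotientRight q) (groupFiltration φ d)))
          (Module.finrank k (LieSpace k A) - Module.finrank k (LieSpace k B)) ∧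
        HasPolynomialGrowth
          (fun d => Module.finrank k (q.range.toSubmodule ⊓ groupFiltration φ d : Submodule k A))
          (Module.finrank k (LieSpace k A) - Module.finrank k (LieSpace k B)) := by
  refine ⟨hasPolynomialGrowth_groupFiltration hφ, ?_⟩
  intro B C _ _ _ _ _ _ π hπ q hq
  have := isNoetherianRing_of_smooth k A
  have := isNoetherianRing_of_smooth k B
  obtain ⟨e, h, x, hA, hB, hx, hxq, hxB⟩ := hq.exists_coordinates hπ
  rw [hA, hB, Nat.add_sub_cancel]
  exact ⟨Nat.le_add_left h e, hq.hasPolynomialGrowth_regularPart hφ hx hxq hxB,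
    hq.hasPolynomialGrowth_inf hφ hx hxq hxB⟩
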